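/- Let $n\ge 2$. There exist $v\in L^\infty(\mathbb{R}^n_x\times\mathbb{R}_t;\mathbb{R}^n)$ and $p\in L^\infty(\mathbb{R}^n_x\times\mathbb{R}_t)$ which solve the incompressible Euler equations without external force, $$\partial_t v+\operatorname{div}(v\otimes v)+\nabla p=0,\qquad \operatorname{div} v=0,$$ in the sense of distributions on $\mathbb{R}^n_x\times\mathbb{R}_t$, that is, $$\int\Big(v\cdot\partial_t\varphi+\sum_{i,j=1}^n v_iv_j\,\partial_{x_j}\varphi_i+p\,\operatorname{div}_x\varphi\Big)\,dx\,dt=0,\qquad \int v\cdot\nabla_x\psi\,dx\,dt=0$$ for all $\varphi\in C_c^\infty(\mathbb{R}^n\times\mathbb{R};\mathbb{R}^n)$ and all $\psi\in C_c^\infty(\mathbb{R}^n\times\mathbb{R})$, such that $v$ is not identically zero (as an element of $L^\infty$), $\operatorname{supp} v$ and $\operatorname{supp} p$ are compact in $\mathbb{R}^n_x\times\mathbb{R}_t$, and moreover - $\int_{\mathbb{R}^n}|v(x,t)|^2\,dx=1$ for almost every $t\in(-1,1)$, - $v(x,t)=0$ for $|t|>1$. -/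

import Mathlib

open MeasureTheory
open scoped ContDiff

/-- Space-time `ℝⁿ × ℝ`; a point is `(x, t)`. Its `volume` is Lebesgue measure `dx dt`. -/
abbrev SpaceTime (n : ℕ) : Type := EuclideanSpace ℝ (Fin n) × ℝ

/-- The partial derivative `∂ₜ φ (y)` at the space-time point `y`. -/
noncomputable def timeDeriv {n : ℕ} {F : Type*} [NormedAddCommGroup F] [NormedSpace ℝ F]
    (φ : SpaceTime n → F) (y : SpaceTime n) : F :=
  fderiv ℝ φ y (0, 1)

/-- The partial derivative `∂φ/∂xⱼ (y)` at the space-time point `y`. -/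
noncomputable def spaceDeriv {n : ℕ} {F : Type*} [NormedAddCommGroup F] [NormedSpace ℝ F]
    (j : Fin n) (φ : SpaceTime n → F) (y : SpaceTime n) : F :=
  fderiv ℝ φ y (EuclideanSpace.single j 1, 0)

/-- `(v, p)` solves the incompressible Euler equations with force `f`,
`∂ₜ v + div (v ⊗ v) + ∇ p - f = 0` and `div v = 0`, in the sense of distributions on
`ℝⁿ × ℝ`. All the terms are distributions because `v`, `|v|²`, `p` and `f` are locally
integrable. -/
structure IsDistributionalEulerSolution {n : ℕ}
    (f v : SpaceTime n → EuclideanSpace ℝ (Fin n)) (p : SpaceTime n → ℝ) : Prop where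
  locallyIntegrable_force : LocallyIntegrable f volume
  locallyIntegrable_velocity : LocallyIntegrable v volume
  locallyIntegrable_velocity_sq : LocallyIntegrable (fun y => ‖v y‖ ^ 2) volume
  locallyIntegrable_pressure : LocallyIntegrable p volume
  momentum : ∀ φ : SpaceTime n → EuclideanSpace ℝ (Fin n),
    ContDiff ℝ ∞ φ → HasCompactSupport φ →
      ∫ y, ((∑ i, v y i * timeDeriv φ y i)
        + (∑ i, ∑ j, v y i * v y j * spaceDeriv j φ y i)
        + p y * (∑ i, spaceDeriv i φ y i)
        + ∑ i, f y i * φ y i) = 0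
  incompressible : ∀ ψ : SpaceTime n → ℝ,
    ContDiff ℝ ∞ ψ → HasCompactSupport ψ →
      ∫ y, (∑ i, v y i * spaceDeriv i ψ y) = 0

/-! The Euler equations split into the linear system `∂ₜ v + div u + ∇ q = 0`, `div v = 0`, with `u`
symmetric and trace free, and the pointwise constraint `u = v ⊗ v - c Id` on a bounded open set `Q`.
The constraint is relaxed to `v ⊗ v - u < c Id` (`IsStrictState`), which the zero state satisfies.
The defect matrix `c Id + u - v ⊗ v` is then positive definite with trace `n c - |v|²`. Since the
trace controls every entry (`IsStrictState.abs_defectMatrix_le`), driving `|v|²` up to `n c`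
restores the constraint in the limit, and the limit solves Euler with pressure `q - c 1_Q`.

The push comes from plane waves. Moving `(v, u)` in the direction `(η, w ⊗ η + η ⊗ w)` with `w = v -
(v · η) η` changes the defect matrix only by a multiple of `η ⊗ η` (`defectForm_segment`). If `η` is
an eigenvector whose eigenvalue is at least trace over `n`, a segment of length proportional to `n c
- |v|²` stays strict (`IsStrictState.exists_segment`). Fast oscillations along this segment can be
localized while solving the linear system exactly, because they derive from a potential
(`exists_localized_wave`). They are almost orthogonal in `L²` to any given fields, so they add
energy. Placed on finitely many disjoint balls that carry half of the defect integral, they raise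
the energy by a fixed multiple of `∫_Q (n c - |v|²)²` (`IsSubsolution.exists_perturbation`).

Along the iteration the energies are bounded by `n c |Q|`, so the gains, and with them the defects,
tend to zero. Weak convergence would not pass through the nonlinear constraint; almost orthogonality
to all earlier velocities upgrades convergence of the energies to strong `L²` convergence
(`cauchySeq_of_almost_orthogonal`). It remains to take `Q` to be a space-time cylinder and to
normalize `c`. -/

instance isAddHaarMeasure_spaceTime (n : ℕ) :
    (volume : Measure (SpaceTime n)).IsAddHaarMeasure :=
  inferInstanceAs (((volume : Measure (EuclideanSpace ℝ (Fin n))).prod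
    (volume : Measure ℝ)).IsAddHaarMeasure)

/-! ### Directional derivatives and null Lagrangians -/

section DirectionalDerivative

variable {V : Type*} [NormedAddCommGroup V] [NormedSpace ℝ V]

/-- The derivative of a scalar function in the direction `a`. -/
noncomputable def dirDeriv (a : V) (f : V → ℝ) (y : V) : ℝ := fderiv ℝ f y a

theorem ContDiff.dirDeriv {f : V → ℝ} (hf : ContDiff ℝ ∞ f) (a : V) :
    ContDiff ℝ ∞ (dirDeriv a f) := by
  unfold _root_.dirDeriv
  exact (hf.fderiv_right (m := ∞) (by simp)).clm_apply contDiff_const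

theorem HasCompactSupport.dirDeriv {f : V → ℝ} (hf : HasCompactSupport f) (a : V) :
    HasCompactSupport (dirDeriv a f) :=
  hf.fderiv_apply ℝ a

theorem tsupport_dirDeriv_subset (a : V) (f : V → ℝ) :
    tsupport (dirDeriv a f) ⊆ tsupport f :=
  tsupport_fderiv_apply_subset ℝ a

theorem dirDeriv_comm {f : V → ℝ} (hf : ContDiff ℝ ∞ f) (a b : V) :
    dirDeriv a (dirDeriv b f) = dirDeriv b (dirDeriv a f) := by
  have hd : Differentiable ℝ (fderiv ℝ f) :=
    (hf.fderiv_right (m := ∞) (by simp)).differentiable (by simp)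
  have key : ∀ (a b y : V), dirDeriv a (dirDeriv b f) y = fderiv ℝ (fderiv ℝ f) y a b := by
    intro a b y
    have : HasFDerivAt (dirDeriv b f) _ y := (hd y).hasFDerivAt.clm_apply (hasFDerivAt_const b y)
    rw [dirDeriv, this.fderiv]
    simp
  funext y
  rw [key, key]
  exact second_derivative_symmetric (fun y => (hf.differentiable (by simp) y).hasFDerivAt)
    (hd y).hasFDerivAt a b

variable [MeasurableSpace V] [BorelSpace V] {μ : Measure V} [μ.IsAddHaarMeasure]

theorem integrable_dirDeriv_mul_dirDeriv {h f : V → ℝ} (hh : ContDiff ℝ ∞ h)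
    (hf : ContDiff ℝ ∞ f) (hfc : HasCompactSupport f) (a c : V) :
    Integrable (fun y => dirDeriv a h y * dirDeriv c f y) μ :=
  ((hh.dirDeriv a).continuous.mul (hf.dirDeriv c).continuous).integrable_of_hasCompactSupport
    (hfc.dirDeriv c).mul_left

theorem integrable_jacobian {h f : V → ℝ} (hh : ContDiff ℝ ∞ h)
    (hf : ContDiff ℝ ∞ f) (hfc : HasCompactSupport f) (a c : V) :
    Integrable (fun y => dirDeriv a h y * dirDeriv c f y - dirDeriv c h y * dirDeriv a f y) μ :=
  (integrable_dirDeriv_mul_dirDeriv hh hf hfc a c).sub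
    (integrable_dirDeriv_mul_dirDeriv hh hf hfc c a)

variable [FiniteDimensional ℝ V]

theorem integral_dirDeriv_mul {f g : V → ℝ} (hf : ContDiff ℝ ∞ f) (hg : ContDiff ℝ ∞ g)
    (hgc : HasCompactSupport g) (a : V) :
    ∫ y, f y * dirDeriv a g y ∂μ = -∫ y, dirDeriv a f y * g y ∂μ := by
  have h (F G : V → ℝ) (hF : ContDiff ℝ ∞ F) (hG : ContDiff ℝ ∞ G) (hGc : HasCompactSupport G) :
      Integrable (fun y => F y * G y) μ :=
    (hF.continuous.mul hG.continuous).integrable_of_hasCompactSupport hGc.mul_left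
  exact integral_mul_fderiv_eq_neg_fderiv_mul_of_integrable
    (h _ _ (hf.dirDeriv a) hg hgc) (h _ _ hf (hg.dirDeriv a) (hgc.dirDeriv a))
    (h _ _ hf hg hgc)
    (fun x _ => hf.differentiable (by simp) x) (fun x _ => hg.differentiable (by simp) x)

/-- The Jacobian `∂ₐh ∂_c f - ∂_c h ∂ₐf` is a null Lagrangian. -/
theorem integral_jacobian_eq_zero {h f : V → ℝ} (hh : ContDiff ℝ ∞ h)
    (hf : ContDiff ℝ ∞ f) (hfc : HasCompactSupport f) (a c : V) :
    ∫ y, (dirDeriv a h y * dirDeriv c f y - dirDeriv c h y * dirDeriv a f y) ∂μ = 0 := by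
  rw [integral_sub (integrable_dirDeriv_mul_dirDeriv hh hf hfc a c)
    (integrable_dirDeriv_mul_dirDeriv hh hf hfc c a), sub_eq_zero]
  -- Integrating by parts moves the derivative off `h` in both products; the results agree by
  -- symmetry of the second derivative of `f`.
  have h1 := integral_dirDeriv_mul (μ := μ) hh (hf.dirDeriv c) (hfc.dirDeriv c) a
  have h2 := integral_dirDeriv_mul (μ := μ) hh (hf.dirDeriv a) (hfc.dirDeriv a) c
  rw [dirDeriv_comm hf] at h1
  linarith

end DirectionalDerivative

/-! ### High-frequency plane waves -/

section Oscillation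

variable {V : Type*} [NormedAddCommGroup V] [NormedSpace ℝ V]

/-- The potential of a localized plane wave of frequency `N`. -/
noncomputable def wavePotential (amp : ℝ) (χ : V → ℝ) (ℓ : V →L[ℝ] ℝ) (N : ℝ) (y : V) : ℝ :=
  -(amp / N ^ 2) * (χ y * Real.cos (N * ℓ y))

theorem contDiff_wavePotential {χ : V → ℝ} (hχ : ContDiff ℝ ∞ χ) (amp : ℝ) (ℓ : V →L[ℝ] ℝ)
    (N : ℝ) : ContDiff ℝ ∞ (wavePotential amp χ ℓ N) := by
  unfold wavePotential
  fun_prop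

theorem tsupport_wavePotential_subset (amp : ℝ) (χ : V → ℝ) (ℓ : V →L[ℝ] ℝ) (N : ℝ) :
    tsupport (wavePotential amp χ ℓ N) ⊆ tsupport χ := by
  refine closure_mono fun y hy => ?_
  simp only [wavePotential, Function.mem_support] at hy ⊢
  intro h
  simp [h] at hy

theorem dirDeriv_wavePotential {χ : V → ℝ} (hχ : ContDiff ℝ ∞ χ) (amp : ℝ) (ℓ : V →L[ℝ] ℝ)
    (N : ℝ) (b y : V) :
    dirDeriv b (wavePotential amp χ ℓ N) y =
      -(amp / N ^ 2) * (dirDeriv b χ y * Real.cos (N * ℓ y)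
        - χ y * (N * ℓ b * Real.sin (N * ℓ y))) := by
  have h1 : HasFDerivAt χ (fderiv ℝ χ y) y := (hχ.differentiable (by simp) y).hasFDerivAt
  have h2 : HasFDerivAt (fun y => N * ℓ y) (N • ℓ) y := ℓ.hasFDerivAt.const_mul N
  have h3 := (h1.mul h2.cos).const_mul (-(amp / N ^ 2))
  have h4 : HasFDerivAt (wavePotential amp χ ℓ N) _ y := h3
  rw [dirDeriv, h4.fderiv]
  simp [dirDeriv]
  ring

theorem dirDeriv_dirDeriv_wavePotential {χ : V → ℝ} (hχ : ContDiff ℝ ∞ χ) (amp : ℝ)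
    (ℓ : V →L[ℝ] ℝ) {N : ℝ} (hN : N ≠ 0) (a b y : V) :
    dirDeriv a (dirDeriv b (wavePotential amp χ ℓ N)) y =
      χ y * Real.cos (N * ℓ y) * amp * (ℓ a * ℓ b)
      + (amp * (ℓ b * dirDeriv a χ y + ℓ a * dirDeriv b χ y) * Real.sin (N * ℓ y)) / N
      - (amp * dirDeriv a (dirDeriv b χ) y * Real.cos (N * ℓ y)) / N ^ 2 := by
  have h1 : HasFDerivAt χ (fderiv ℝ χ y) y := (hχ.differentiable (by simp) y).hasFDerivAt
  have h1' : HasFDerivAt (dirDeriv b χ) (fderiv ℝ (dirDeriv b χ) y) y :=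
    ((hχ.dirDeriv b).differentiable (by simp) y).hasFDerivAt
  have h2 : HasFDerivAt (fun y => N * ℓ y) (N • ℓ) y := ℓ.hasFDerivAt.const_mul N
  have h3 := (((h1'.mul h2.cos).sub (h1.mul (h2.sin.const_mul (N * ℓ b))))).const_mul
    (-(amp / N ^ 2))
  have h4 : HasFDerivAt (dirDeriv b (wavePotential amp χ ℓ N)) _ y :=
    h3.congr_of_eventuallyEq
      (Filter.Eventually.of_forall fun y => dirDeriv_wavePotential hχ amp ℓ N b y)
  rw [dirDeriv, h4.fderiv]
  simp [dirDeriv]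
  field_simp
  ring

/-- The prefactor `1 / N²` is compensated only when both derivatives hit the cosine. Each derivative
falling on `χ` instead costs a factor `1 / N`, uniformly in `y`. -/
theorem exists_bound_dirDeriv_wavePotential {χ : V → ℝ} (hχ : ContDiff ℝ ∞ χ)
    (hχc : HasCompactSupport χ) (amp : ℝ) (ℓ : V →L[ℝ] ℝ) (a b : V) :
    ∃ C, 0 ≤ C ∧ ∀ N : ℝ, 1 ≤ N → ∀ y,
      |dirDeriv a (dirDeriv b (wavePotential amp χ ℓ N)) y
        - χ y * Real.cos (N * ℓ y) * amp * (ℓ a * ℓ b)| ≤ C / N := by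
  obtain ⟨A, hA⟩ : ∃ A, ∀ y, ‖amp * (ℓ b * dirDeriv a χ y + ℓ a * dirDeriv b χ y)‖ ≤ A := by
    refine HasCompactSupport.exists_bound_of_continuous ?_ ?_
    · exact (((hχc.dirDeriv a).mul_left).add ((hχc.dirDeriv b).mul_left)).mul_left
    · have := (hχ.dirDeriv a).continuous
      have := (hχ.dirDeriv b).continuous
      fun_prop
  obtain ⟨B, hB⟩ : ∃ B, ∀ y, ‖amp * dirDeriv a (dirDeriv b χ) y‖ ≤ B :=
    HasCompactSupport.exists_bound_of_continuous (((hχc.dirDeriv b).dirDeriv a).mul_left)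
      (continuous_const.mul ((hχ.dirDeriv b).dirDeriv a).continuous)
  have hA0 : 0 ≤ A := (norm_nonneg _).trans (hA 0)
  have hB0 : 0 ≤ B := (norm_nonneg _).trans (hB 0)
  refine ⟨A + B, by positivity, fun N hN y => ?_⟩
  have hN0 : 0 < N := by linarith
  rw [dirDeriv_dirDeriv_wavePotential hχ amp ℓ hN0.ne']
  have e1 : |(amp * (ℓ b * dirDeriv a χ y + ℓ a * dirDeriv b χ y) * Real.sin (N * ℓ y)) / N|
      ≤ A / N := by
    rw [abs_div, abs_mul, abs_of_pos hN0]
    gcongr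
    calc _ ≤ A * 1 := mul_le_mul (hA y) (Real.abs_sin_le_one _) (abs_nonneg _) hA0
      _ = A := mul_one A
  have e2 : |(amp * dirDeriv a (dirDeriv b χ) y * Real.cos (N * ℓ y)) / N ^ 2| ≤ B / N := by
    rw [abs_div, abs_mul, abs_of_pos (pow_pos hN0 2)]
    have : N ≤ N ^ 2 := by nlinarith
    gcongr
    calc _ ≤ B * 1 := mul_le_mul (hB y) (Real.abs_cos_le_one _) (abs_nonneg _) hB0
      _ = B := mul_one B
  rw [add_div]
  refine le_trans (le_of_eq ?_) ((abs_sub _ _).trans (add_le_add e1 e2))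
  congr 1
  ring

/-- The Riemann–Lebesgue lemma along the ray spanned by `ℓ` in the dual space. The factor `2π` below
comes from the normalization of the Fourier character, and the cosine is the real part. -/
theorem tendsto_integral_cos_mul {V : Type*} [NormedAddCommGroup V] [NormedSpace ℝ V]
    [MeasurableSpace V] [BorelSpace V] [FiniteDimensional ℝ V] (μ : Measure V)
    [μ.IsAddHaarMeasure] {ℓ : V →L[ℝ] ℝ} (hℓ : ℓ ≠ 0) {f : V → ℝ} (hf : Integrable f μ) :
    Filter.Tendsto (fun N : ℝ => ∫ y, Real.cos (N * ℓ y) * f y ∂μ) Filter.atTop (nhds 0) := by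
  have h := tendsto_integral_exp_smul_cocompact (fun y => (f y : ℂ)) μ
  have hmap : Filter.Tendsto (fun N : ℝ => (-(N / (2 * Real.pi))) • ℓ) Filter.atTop
      (Filter.cocompact (StrongDual ℝ V)) := by
    rw [← Metric.cobounded_eq_cocompact, ← tendsto_norm_atTop_iff_cobounded]
    have hpos : 0 < ‖ℓ‖ / (2 * Real.pi) := by positivity
    refine (Filter.tendsto_id.atTop_mul_const hpos).congr' ?_
    filter_upwards [Filter.eventually_ge_atTop 0] with N hN
    rw [norm_smul, norm_neg, Real.norm_of_nonneg (by positivity)]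
    simp only [id]
    ring
  have h2 := (Complex.continuous_re.tendsto _).comp (h.comp hmap)
  simp only [Complex.zero_re] at h2
  refine h2.congr fun N => ?_
  simp only [Function.comp_apply]
  have hint : Integrable (fun y => Real.fourierChar (-((-(N / (2 * Real.pi))) • ℓ) y) •
      (f y : ℂ)) μ := by
    have hfc : Integrable (fun y => (f y : ℂ)) μ := hf.ofReal
    refine hfc.mono ?_ (Filter.Eventually.of_forall fun y => by simp)
    refine AEStronglyMeasurable.smul ?_ hfc.aestronglyMeasurable
    have hc : Continuous fun y => -((-(N / (2 * Real.pi))) • ℓ) y := by fun_prop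
    exact (continuous_subtype_val.comp (Real.continuous_fourierChar.comp hc)).aestronglyMeasurable
  rw [← RCLike.re_eq_complex_re, ← integral_re hint]
  refine integral_congr_ae (Filter.Eventually.of_forall fun y => ?_)
  simp only [Circle.smul_def, Real.fourierChar_apply]
  have : (2 * Real.pi * -(((-(N / (2 * Real.pi))) • ℓ) y) : ℝ) = N * ℓ y := by
    simp; field_simp
  rw [this, smul_eq_mul, RCLike.re_eq_complex_re, Complex.re_mul_ofReal,
    Complex.exp_ofReal_mul_I_re]

end Oscillation

/-- The integrand of the weak formulation of `∂ₜ v + div u + ∇ q = 0`, tested with `φ`. -/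
noncomputable def momentumPairing {n : ℕ} (φ : SpaceTime n → EuclideanSpace ℝ (Fin n))
    (y : SpaceTime n) (v : EuclideanSpace ℝ (Fin n)) (u : Fin n → Fin n → ℝ) (q : ℝ) : ℝ :=
  (∑ i, v i * timeDeriv φ y i) + (∑ i, ∑ j, u i j * spaceDeriv j φ y i)
    + q * (∑ i, spaceDeriv i φ y i)

/-- The integrand of the weak formulation of `div v = 0`, tested with `ψ`. -/
noncomputable def divergencePairing {n : ℕ} (ψ : SpaceTime n → ℝ)
    (y : SpaceTime n) (v : EuclideanSpace ℝ (Fin n)) : ℝ :=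
  ∑ i, v i * spaceDeriv i ψ y

/-! ### The weak formulation as a pairing with test functions -/

section Pairing

variable {n : ℕ}

theorem momentumPairing_add (φ : SpaceTime n → EuclideanSpace ℝ (Fin n)) (y : SpaceTime n)
    (v v' : EuclideanSpace ℝ (Fin n)) (u u' : Fin n → Fin n → ℝ) (q q' : ℝ) :
    momentumPairing φ y (v + v') (u + u') (q + q') =
      momentumPairing φ y v u q + momentumPairing φ y v' u' q' := by
  simp only [momentumPairing, PiLp.add_apply, Pi.add_apply, add_mul, Finset.sum_add_distrib]
  ring

theorem divergencePairing_add (ψ : SpaceTime n → ℝ) (y : SpaceTime n)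
    (v v' : EuclideanSpace ℝ (Fin n)) :
    divergencePairing ψ y (v + v') = divergencePairing ψ y v + divergencePairing ψ y v' := by
  simp only [divergencePairing, PiLp.add_apply, add_mul, Finset.sum_add_distrib]

theorem continuous_timeDeriv {F : Type*} [NormedAddCommGroup F] [NormedSpace ℝ F]
    {φ : SpaceTime n → F} (hφ : ContDiff ℝ ∞ φ) : Continuous (timeDeriv φ) :=
  (hφ.continuous_fderiv (by simp)).clm_apply continuous_const

theorem continuous_spaceDeriv {F : Type*} [NormedAddCommGroup F] [NormedSpace ℝ F]
    {φ : SpaceTime n → F} (hφ : ContDiff ℝ ∞ φ) (j : Fin n) : Continuous (spaceDeriv j φ) :=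
  (hφ.continuous_fderiv (by simp)).clm_apply continuous_const

theorem fderiv_eq_zero_of_notMem_tsupport {F : Type*} [NormedAddCommGroup F] [NormedSpace ℝ F]
    {φ : SpaceTime n → F} {y : SpaceTime n} (hy : y ∉ tsupport φ) : fderiv ℝ φ y = 0 :=
  image_eq_zero_of_notMem_tsupport fun h => hy (tsupport_fderiv_subset ℝ h)

theorem momentumPairing_eq_zero {φ : SpaceTime n → EuclideanSpace ℝ (Fin n)} {y : SpaceTime n}
    (hy : y ∉ tsupport φ) (v : EuclideanSpace ℝ (Fin n)) (u : Fin n → Fin n → ℝ) (q : ℝ) :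
    momentumPairing φ y v u q = 0 := by
  simp [momentumPairing, timeDeriv, spaceDeriv, fderiv_eq_zero_of_notMem_tsupport hy]

theorem divergencePairing_eq_zero {ψ : SpaceTime n → ℝ} {y : SpaceTime n}
    (hy : y ∉ tsupport ψ) (v : EuclideanSpace ℝ (Fin n)) : divergencePairing ψ y v = 0 := by
  simp [divergencePairing, spaceDeriv, fderiv_eq_zero_of_notMem_tsupport hy]

theorem integrable_momentumPairing {φ : SpaceTime n → EuclideanSpace ℝ (Fin n)}
    (hφ : ContDiff ℝ ∞ φ) (hφc : HasCompactSupport φ) {v : SpaceTime n → EuclideanSpace ℝ (Fin n)}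
    {u : SpaceTime n → Fin n → Fin n → ℝ} {q : SpaceTime n → ℝ}
    (hv : Continuous v) (hu : Continuous u) (hq : Continuous q) :
    Integrable (fun y => momentumPairing φ y (v y) (u y) (q y)) := by
  refine Continuous.integrable_of_hasCompactSupport ?_
    (HasCompactSupport.intro hφc fun y hy => momentumPairing_eq_zero hy _ _ _)
  have h1 := continuous_timeDeriv hφ
  have h2 := continuous_spaceDeriv hφ
  unfold momentumPairing
  fun_prop

theorem integrable_divergencePairing {ψ : SpaceTime n → ℝ}
    (hψ : ContDiff ℝ ∞ ψ) (hψc : HasCompactSupport ψ) {v : SpaceTime n → EuclideanSpace ℝ (Fin n)}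
    (hv : Continuous v) : Integrable (fun y => divergencePairing ψ y (v y)) := by
  refine Continuous.integrable_of_hasCompactSupport ?_
    (HasCompactSupport.intro hψc fun y hy => divergencePairing_eq_zero hy _)
  have h2 := continuous_spaceDeriv hψ
  unfold divergencePairing
  fun_prop

end Pairing

/-- Continuous compactly supported distributional solutions of the linear system
`∂ₜ v + div u + ∇ q = 0`, `div v = 0` with `u` symmetric and trace free. -/
structure IsLinearEulerSolution {n : ℕ} (v : SpaceTime n → EuclideanSpace ℝ (Fin n))
    (u : SpaceTime n → Fin n → Fin n → ℝ) (q : SpaceTime n → ℝ) : Prop where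
  continuous_velocity : Continuous v
  continuous_stress : Continuous u
  continuous_pressure : Continuous q
  compact_velocity : HasCompactSupport v
  stress_symm : ∀ y i j, u y i j = u y j i
  stress_trace : ∀ y, ∑ i, u y i i = 0
  momentum : ∀ φ : SpaceTime n → EuclideanSpace ℝ (Fin n),
    ContDiff ℝ ∞ φ → HasCompactSupport φ → ∫ y, momentumPairing φ y (v y) (u y) (q y) = 0
  incompressible : ∀ ψ : SpaceTime n → ℝ,
    ContDiff ℝ ∞ ψ → HasCompactSupport ψ → ∫ y, divergencePairing ψ y (v y) = 0

namespace IsLinearEulerSolution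

variable {n : ℕ} {v v' : SpaceTime n → EuclideanSpace ℝ (Fin n)}
  {u u' : SpaceTime n → Fin n → Fin n → ℝ} {q q' : SpaceTime n → ℝ}

theorem zero : IsLinearEulerSolution (n := n) 0 0 0 where
  continuous_velocity := continuous_zero
  continuous_stress := continuous_zero
  continuous_pressure := continuous_zero
  compact_velocity := HasCompactSupport.zero
  stress_symm := by simp
  stress_trace := by simp
  momentum := by simp [momentumPairing]
  incompressible := by simp [divergencePairing]

theorem add (h : IsLinearEulerSolution v u q) (h' : IsLinearEulerSolution v' u' q') :
    IsLinearEulerSolution (v + v') (u + u') (q + q') where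
  continuous_velocity := h.continuous_velocity.add h'.continuous_velocity
  continuous_stress := h.continuous_stress.add h'.continuous_stress
  continuous_pressure := h.continuous_pressure.add h'.continuous_pressure
  compact_velocity := h.compact_velocity.add h'.compact_velocity
  stress_symm y i j := by simp [h.stress_symm y i j, h'.stress_symm y i j]
  stress_trace y := by simp [Finset.sum_add_distrib, h.stress_trace y, h'.stress_trace y]
  momentum φ hφ hφc := by
    simp only [Pi.add_apply v, Pi.add_apply u, Pi.add_apply q, momentumPairing_add]
    rw [integral_add
      (integrable_momentumPairing hφ hφc h.continuous_velocity h.continuous_stress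
        h.continuous_pressure)
      (integrable_momentumPairing hφ hφc h'.continuous_velocity h'.continuous_stress
        h'.continuous_pressure), h.momentum φ hφ hφc, h'.momentum φ hφ hφc, add_zero]
  incompressible ψ hψ hψc := by
    simp only [Pi.add_apply v, divergencePairing_add]
    rw [integral_add (integrable_divergencePairing hψ hψc h.continuous_velocity)
      (integrable_divergencePairing hψ hψc h'.continuous_velocity),
      h.incompressible ψ hψ hψc, h'.incompressible ψ hψ hψc, add_zero]

end IsLinearEulerSolution

/-! ### Exact solutions of the linear system from a potential -/

section Wave

variable {n : ℕ}

/-- The symmetric product `a ⊗ b + b ⊗ a`. -/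
def symProd (a b : EuclideanSpace ℝ (Fin n)) (i j : Fin n) : ℝ := a i * b j + b i * a j

theorem symProd_symm (a b : EuclideanSpace ℝ (Fin n)) (i j : Fin n) :
    symProd a b i j = symProd a b j i := by
  simp only [symProd]; ring

theorem sum_symProd_diag (a b : EuclideanSpace ℝ (Fin n)) :
    ∑ i, symProd a b i i = 2 * inner ℝ a b := by
  simp only [symProd, PiLp.inner_apply, RCLike.inner_apply, conj_trivial, Finset.mul_sum]
  exact Finset.sum_congr rfl fun i _ => by ring

theorem sum_mul_timeDeriv (φ : SpaceTime n → EuclideanSpace ℝ (Fin n)) (y : SpaceTime n)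
    (p : EuclideanSpace ℝ (Fin n)) :
    ∑ i, p i * timeDeriv φ y i = inner ℝ p (fderiv ℝ φ y (0, 1)) := by
  simp only [timeDeriv, PiLp.inner_apply, RCLike.inner_apply, conj_trivial]
  exact Finset.sum_congr rfl fun i _ => by ring

theorem sum_smul_single_prod (p : EuclideanSpace ℝ (Fin n)) :
    ∑ j, p j • ((EuclideanSpace.single j (1 : ℝ), (0 : ℝ)) : SpaceTime n) = (p, 0) := by
  ext i
  · simp [Prod.fst_sum, Pi.single_apply]
  · simp [Prod.snd_sum]

theorem sum_mul_spaceDeriv {F : Type*} [NormedAddCommGroup F] [NormedSpace ℝ F]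
    (φ : SpaceTime n → F) (y : SpaceTime n) (p : EuclideanSpace ℝ (Fin n)) :
    ∑ j, p j • spaceDeriv j φ y = fderiv ℝ φ y (p, 0) := by
  rw [← sum_smul_single_prod p, map_sum]
  simp only [spaceDeriv, map_smul]

theorem sum_symProd_mul_spaceDeriv (φ : SpaceTime n → EuclideanSpace ℝ (Fin n)) (y : SpaceTime n)
    (a b : EuclideanSpace ℝ (Fin n)) :
    ∑ i, ∑ j, symProd a b i j * spaceDeriv j φ y i =
      inner ℝ a (fderiv ℝ φ y (b, 0)) + inner ℝ b (fderiv ℝ φ y (a, 0)) := by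
  rw [← sum_mul_spaceDeriv, ← sum_mul_spaceDeriv]
  simp only [PiLp.inner_apply, RCLike.inner_apply, conj_trivial, symProd, ← Finset.sum_add_distrib]
  refine Finset.sum_congr rfl fun i _ => ?_
  simp only [WithLp.ofLp_sum, WithLp.ofLp_smul, Finset.sum_apply, Pi.smul_apply, smul_eq_mul,
    Finset.sum_mul, ← Finset.sum_add_distrib]
  exact Finset.sum_congr rfl fun i _ => by ring

theorem dirDeriv_inner {φ : SpaceTime n → EuclideanSpace ℝ (Fin n)} (hφ : ContDiff ℝ ∞ φ)
    (p : EuclideanSpace ℝ (Fin n)) (a y : SpaceTime n) :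
    dirDeriv a (fun y => inner ℝ p (φ y)) y = inner ℝ p (fderiv ℝ φ y a) := by
  have h := (innerSL ℝ p).hasFDerivAt.comp y (hφ.differentiable (by simp) y).hasFDerivAt
  have h' : HasFDerivAt (fun y => inner ℝ p (φ y)) _ y := h
  rw [dirDeriv, h'.fderiv]
  simp

/-- The velocity generated by the potential `Φ` in the directions `η` and `ζ`. -/
noncomputable def waveVelocity (η ζ : EuclideanSpace ℝ (Fin n)) (Φ : SpaceTime n → ℝ)
    (y : SpaceTime n) : EuclideanSpace ℝ (Fin n) :=
  dirDeriv (ζ, 0) (dirDeriv (ζ, 0) Φ) y • η - dirDeriv (ζ, 0) (dirDeriv (η, 0) Φ) y • ζ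

/-- The trace of the momentum flux generated by the potential `Φ`, divided by `n`. -/
noncomputable def wavePressure (w η ζ : EuclideanSpace ℝ (Fin n)) (Φ : SpaceTime n → ℝ)
    (y : SpaceTime n) : ℝ :=
  2 * (dirDeriv (w, 1) (dirDeriv (η, 0) Φ) y
    - inner ℝ w ζ * dirDeriv (ζ, 0) (dirDeriv (η, 0) Φ) y) / n

/-- The trace free part of the momentum flux generated by the potential `Φ`. -/
noncomputable def waveStress (w η ζ : EuclideanSpace ℝ (Fin n)) (Φ : SpaceTime n → ℝ)
    (y : SpaceTime n) (i j : Fin n) : ℝ :=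
  dirDeriv (ζ, 0) (dirDeriv (ζ, 0) Φ) y * symProd w η i j
    - dirDeriv (ζ, 0) (dirDeriv (η, 0) Φ) y * symProd w ζ i j
    - dirDeriv (w, 1) (dirDeriv (ζ, 0) Φ) y * symProd ζ η i j
    + dirDeriv (w, 1) (dirDeriv (η, 0) Φ) y * symProd ζ ζ i j
    - if i = j then wavePressure w η ζ Φ y else 0

/-- Each bracket is a Jacobian of a first derivative of `Φ` (along `ζ`, `ζ`, `η`, `(w, 1)` in turn)
against a component of `φ`, hence integrates to zero. The terms with second derivatives along `η`
and `w` only cancel between the last brackets and the second. The pressure drops out because the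
same multiple of the identity was removed from the stress. -/
theorem momentumPairing_wave {φ : SpaceTime n → EuclideanSpace ℝ (Fin n)} (hφ : ContDiff ℝ ∞ φ)
    {Φ : SpaceTime n → ℝ} (hΦ : ContDiff ℝ ∞ Φ) (w η ζ : EuclideanSpace ℝ (Fin n))
    (y : SpaceTime n) :
    momentumPairing φ y (waveVelocity η ζ Φ y) (waveStress w η ζ Φ y) (wavePressure w η ζ Φ y) =
      (dirDeriv (ζ, 0) (dirDeriv (ζ, 0) Φ) y * dirDeriv (w, 1) (fun y => inner ℝ η (φ y)) y
        - dirDeriv (w, 1) (dirDeriv (ζ, 0) Φ) y * dirDeriv (ζ, 0) (fun y => inner ℝ η (φ y)) y)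
      + (dirDeriv (ζ, 0) (dirDeriv (ζ, 0) Φ) y * dirDeriv (η, 0) (fun y => inner ℝ w (φ y)) y
        - dirDeriv (η, 0) (dirDeriv (ζ, 0) Φ) y * dirDeriv (ζ, 0) (fun y => inner ℝ w (φ y)) y)
      + (dirDeriv (w, 1) (dirDeriv (η, 0) Φ) y * dirDeriv (ζ, 0) (fun y => inner ℝ ζ (φ y)) y
        - dirDeriv (ζ, 0) (dirDeriv (η, 0) Φ) y * dirDeriv (w, 1) (fun y => inner ℝ ζ (φ y)) y)
      + (dirDeriv (η, 0) (dirDeriv (w, 1) Φ) y * dirDeriv (ζ, 0) (fun y => inner ℝ ζ (φ y)) y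
        - dirDeriv (ζ, 0) (dirDeriv (w, 1) Φ) y * dirDeriv (η, 0) (fun y => inner ℝ ζ (φ y)) y)
      := by
  simp only [dirDeriv_inner hφ]
  rw [dirDeriv_comm hΦ (η, 0) (ζ, 0), dirDeriv_comm hΦ (η, 0) (w, 1),
    dirDeriv_comm hΦ (ζ, 0) (w, 1)]
  have hw : ((w, 1) : SpaceTime n) = (w, 0) + (0, 1) := by simp
  have hvel : ∑ i, waveVelocity η ζ Φ y i * timeDeriv φ y i =
      dirDeriv (ζ, 0) (dirDeriv (ζ, 0) Φ) y * inner ℝ η (fderiv ℝ φ y (0, 1))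
      - dirDeriv (ζ, 0) (dirDeriv (η, 0) Φ) y * inner ℝ ζ (fderiv ℝ φ y (0, 1)) := by
    rw [sum_mul_timeDeriv, waveVelocity, inner_sub_left, real_inner_smul_left,
      real_inner_smul_left]
  have hstress : (∑ i, ∑ j, waveStress w η ζ Φ y i j * spaceDeriv j φ y i)
      + wavePressure w η ζ Φ y * ∑ i, spaceDeriv i φ y i =
      dirDeriv (ζ, 0) (dirDeriv (ζ, 0) Φ) y *
        (∑ i, ∑ j, symProd w η i j * spaceDeriv j φ y i)
      - dirDeriv (ζ, 0) (dirDeriv (η, 0) Φ) y *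
        (∑ i, ∑ j, symProd w ζ i j * spaceDeriv j φ y i)
      - dirDeriv (w, 1) (dirDeriv (ζ, 0) Φ) y *
        (∑ i, ∑ j, symProd ζ η i j * spaceDeriv j φ y i)
      + dirDeriv (w, 1) (dirDeriv (η, 0) Φ) y *
        (∑ i, ∑ j, symProd ζ ζ i j * spaceDeriv j φ y i) := by
    simp only [waveStress, sub_mul, add_mul, Finset.sum_add_distrib, Finset.sum_sub_distrib,
      ite_mul, zero_mul, Finset.sum_ite_eq, Finset.mem_univ, if_true, Finset.mul_sum, mul_assoc]
    ring
  rw [momentumPairing, add_assoc, hvel, hstress]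
  simp only [sum_symProd_mul_spaceDeriv]
  rw [show (fderiv ℝ φ y) (w, 1) = fderiv ℝ φ y (w, 0) + fderiv ℝ φ y (0, 1) by
    rw [← map_add, ← hw]]
  simp only [inner_add_right]
  ring

theorem divergencePairing_wave (ψ : SpaceTime n → ℝ)
    {Φ : SpaceTime n → ℝ} (hΦ : ContDiff ℝ ∞ Φ) (η ζ : EuclideanSpace ℝ (Fin n))
    (y : SpaceTime n) :
    divergencePairing ψ y (waveVelocity η ζ Φ y) =
      dirDeriv (ζ, 0) (dirDeriv (ζ, 0) Φ) y * dirDeriv (η, 0) ψ y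
        - dirDeriv (η, 0) (dirDeriv (ζ, 0) Φ) y * dirDeriv (ζ, 0) ψ y := by
  have h := sum_mul_spaceDeriv ψ y
  simp only [smul_eq_mul] at h
  rw [divergencePairing, h, waveVelocity, dirDeriv_comm hΦ (η, 0) (ζ, 0)]
  have e : ∀ a b : ℝ, ((a • η - b • ζ, 0) : SpaceTime n) = a • (η, 0) - b • (ζ, 0) := by
    intro a b; simp
  rw [e, map_sub, map_smul, map_smul]
  simp [dirDeriv]

theorem sum_waveStress_diag (hn : n ≠ 0) (w : EuclideanSpace ℝ (Fin n))
    {η ζ : EuclideanSpace ℝ (Fin n)} (hζ : ‖ζ‖ = 1) (hηζ : inner ℝ η ζ = (0 : ℝ))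
    (hwη : inner ℝ w η = (0 : ℝ)) (Φ : SpaceTime n → ℝ) (y : SpaceTime n) :
    ∑ i, waveStress w η ζ Φ y i i = 0 := by
  simp only [waveStress, Finset.sum_add_distrib, Finset.sum_sub_distrib, ← Finset.mul_sum,
    sum_symProd_diag, if_true, Finset.sum_const, Finset.card_univ, Fintype.card_fin]
  rw [hwη, real_inner_comm η ζ, hηζ, real_inner_self_eq_norm_sq, hζ, nsmul_eq_mul, wavePressure]
  have : (n : ℝ) ≠ 0 := by exact_mod_cast hn
  field_simp
  ring

theorem isLinearEulerSolution_wave (hn : n ≠ 0) (w : EuclideanSpace ℝ (Fin n))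
    {η ζ : EuclideanSpace ℝ (Fin n)} (hζ : ‖ζ‖ = 1) (hηζ : inner ℝ η ζ = (0 : ℝ))
    (hwη : inner ℝ w η = (0 : ℝ)) {Φ : SpaceTime n → ℝ} (hΦ : ContDiff ℝ ∞ Φ)
    (hΦc : HasCompactSupport Φ) :
    IsLinearEulerSolution (waveVelocity η ζ Φ) (waveStress w η ζ Φ) (wavePressure w η ζ Φ) := by
  have hc : ∀ a b, Continuous (dirDeriv a (dirDeriv b Φ)) :=
    fun a b => ((hΦ.dirDeriv b).dirDeriv a).continuous
  have hcs : ∀ a b, HasCompactSupport (dirDeriv a (dirDeriv b Φ)) :=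
    fun a b => (hΦc.dirDeriv b).dirDeriv a
  have hp : Continuous (wavePressure w η ζ Φ) := by
    unfold wavePressure
    fun_prop
  refine ⟨?_, ?_, hp, ?_, ?_, sum_waveStress_diag hn w hζ hηζ hwη Φ, ?_, ?_⟩
  · unfold waveVelocity
    fun_prop
  · refine continuous_pi fun i => continuous_pi fun j => ?_
    unfold waveStress
    split_ifs <;> fun_prop
  · exact (hcs _ _).smul_right.sub (hcs _ _).smul_right
  · intro y i j
    simp only [waveStress, symProd_symm _ _ i j, eq_comm (a := i)]
  · intro φ hφ hφc
    have hs : ∀ p, ContDiff ℝ ∞ (fun y => inner ℝ p (φ y)) := fun p => contDiff_const.inner ℝ hφ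
    have hsc : ∀ p : EuclideanSpace ℝ (Fin n), HasCompactSupport (fun y => inner ℝ p (φ y)) :=
      fun p => HasCompactSupport.intro hφc fun y hy => by
        simp [image_eq_zero_of_notMem_tsupport hy]
    have J := fun a b c p => And.intro
      (integrable_jacobian (μ := volume) (hΦ.dirDeriv b) (hs p) (hsc p) a c)
      (integral_jacobian_eq_zero (μ := volume) (hΦ.dirDeriv b) (hs p) (hsc p) a c)
    have key : ∀ {f g : SpaceTime n → ℝ}, (Integrable f ∧ ∫ y, f y = 0) →
        (Integrable g ∧ ∫ y, g y = 0) →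
        Integrable (fun y => f y + g y) ∧ ∫ y, (f y + g y) = 0 := fun hf hg =>
      ⟨hf.1.add hg.1, by rw [integral_add hf.1 hg.1, hf.2, hg.2, add_zero]⟩
    simp only [momentumPairing_wave hφ hΦ]
    exact (key (key (key (J _ _ _ _) (J _ _ _ _)) (J _ _ _ _)) (J _ _ _ _)).2
  · intro ψ hψ hψc
    simp only [divergencePairing_wave ψ hΦ]
    exact integral_jacobian_eq_zero (hΦ.dirDeriv _) hψ hψc _ _

end Wave

/-- The phase `ζ · x - (v₀ · ζ) t` has derivative `1` along `ζ` and is constant along `η` and `(w,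
1)`. Among the second derivatives of the potential that enter the fields, only the one along `ζ, ζ`
is therefore of order one, and it multiplies exactly `η` and `symProd w η`. -/
theorem exists_localized_wave {n : ℕ} (hn : n ≠ 0) (v₀ : EuclideanSpace ℝ (Fin n))
    {η ζ : EuclideanSpace ℝ (Fin n)} (hη : ‖η‖ = 1) (hζ : ‖ζ‖ = 1) (hηζ : inner ℝ η ζ = (0 : ℝ))
    (amp : ℝ) {χ : SpaceTime n → ℝ} (hχ : ContDiff ℝ ∞ χ) (hχc : HasCompactSupport χ) :
    ∃ ℓ : SpaceTime n →L[ℝ] ℝ, ℓ ≠ 0 ∧ ∃ C : ℝ, 0 ≤ C ∧ ∀ N : ℝ, 1 ≤ N →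
      ∃ (d : SpaceTime n → EuclideanSpace ℝ (Fin n)) (e : SpaceTime n → Fin n → Fin n → ℝ)
        (p : SpaceTime n → ℝ), IsLinearEulerSolution d e p ∧
        (∀ y ∉ tsupport χ, d y = 0 ∧ e y = 0 ∧ p y = 0) ∧
        ∀ y, ‖d y - (χ y * Real.cos (N * ℓ y) * amp) • η‖ ≤ C / N ∧
          ‖e y - (χ y * Real.cos (N * ℓ y) * amp) • symProd (v₀ - (inner ℝ v₀ η : ℝ) • η) η‖
            ≤ C / N ∧ |p y| ≤ C / N := by
  set w := v₀ - (inner ℝ v₀ η : ℝ) • η with hw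
  let ℓ : SpaceTime n →L[ℝ] ℝ :=
    (innerSL ℝ ζ).comp (ContinuousLinearMap.fst ℝ _ _)
      - (inner ℝ v₀ ζ : ℝ) • ContinuousLinearMap.snd ℝ _ _
  have hℓ : ∀ x t, ℓ (x, t) = inner ℝ ζ x - inner ℝ v₀ ζ * t := fun x t => by simp [ℓ]
  have hℓζ : ℓ (ζ, 0) = 1 := by rw [hℓ, real_inner_self_eq_norm_sq, hζ]; norm_num
  have hℓη : ℓ (η, 0) = 0 := by rw [hℓ, real_inner_comm, hηζ]; norm_num
  have hwη : inner ℝ w η = (0 : ℝ) := by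
    rw [hw, inner_sub_left, real_inner_smul_left, real_inner_self_eq_norm_sq, hη]; ring
  have hℓw : ℓ (w, 1) = 0 := by
    rw [hℓ, hw, inner_sub_right, real_inner_smul_right, real_inner_comm, real_inner_comm η ζ, hηζ]
    ring
  obtain ⟨C₁, h₁, H₁⟩ := exists_bound_dirDeriv_wavePotential hχ hχc amp ℓ (ζ, 0) (ζ, 0)
  obtain ⟨C₂, h₂, H₂⟩ := exists_bound_dirDeriv_wavePotential hχ hχc amp ℓ (ζ, 0) (η, 0)
  obtain ⟨C₃, h₃, H₃⟩ := exists_bound_dirDeriv_wavePotential hχ hχc amp ℓ (w, 1) (ζ, 0)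
  obtain ⟨C₄, h₄, H₄⟩ := exists_bound_dirDeriv_wavePotential hχ hχc amp ℓ (w, 1) (η, 0)
  simp only [hℓζ, hℓη, hℓw, mul_one, mul_zero, sub_zero] at H₁ H₂ H₃ H₄
  have hn1 : (1 : ℝ) ≤ n := by exact_mod_cast Nat.one_le_iff_ne_zero.2 hn
  set K := 2 * (C₄ + |inner ℝ w ζ| * C₂) with hK
  set S := C₁ * ‖symProd w η‖ + C₂ * ‖symProd w ζ‖ + C₃ * ‖symProd ζ η‖
    + C₄ * ‖symProd ζ ζ‖ with hS
  have hK0 : 0 ≤ K := by positivity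
  have hS0 : 0 ≤ S := by positivity
  refine ⟨ℓ, fun h => by simp [h] at hℓζ, C₁ + C₂ + K + S, by positivity, fun N hN => ?_⟩
  have hN0 : 0 < N := by linarith
  set Φ := wavePotential amp χ ℓ N
  have hΦ : ContDiff ℝ ∞ Φ := contDiff_wavePotential hχ amp ℓ N
  have hΦs : tsupport Φ ⊆ tsupport χ := tsupport_wavePotential_subset amp χ ℓ N
  have hΦc : HasCompactSupport Φ := hχc.of_isClosed_subset (isClosed_tsupport _) hΦs
  have hpress : ∀ y, |wavePressure w η ζ Φ y| ≤ K / N := by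
    intro y
    rw [wavePressure, abs_div, Nat.abs_cast]
    refine (div_le_self (abs_nonneg _) hn1).trans ?_
    rw [abs_mul, abs_two, hK, mul_div_assoc]
    refine mul_le_mul_of_nonneg_left ?_ zero_le_two
    refine (abs_sub _ _).trans ?_
    rw [abs_mul, add_div, mul_div_assoc]
    exact add_le_add (H₄ N hN y) (mul_le_mul_of_nonneg_left (H₂ N hN y) (abs_nonneg _))
  have hmono : ∀ {a b : ℝ}, a ≤ b → a / N ≤ b / N := fun h =>
    div_le_div_of_nonneg_right h hN0.le
  refine ⟨waveVelocity η ζ Φ, waveStress w η ζ Φ, wavePressure w η ζ Φ,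
    isLinearEulerSolution_wave hn w hζ hηζ hwη hΦ hΦc, fun y hy => ?_, fun y => ⟨?_, ?_, ?_⟩⟩
  · have hz : ∀ a b, dirDeriv a (dirDeriv b Φ) y = 0 := fun a b =>
      image_eq_zero_of_notMem_tsupport fun h => hy (hΦs (tsupport_dirDeriv_subset _ _
        (tsupport_dirDeriv_subset _ _ h)))
    have hp : wavePressure w η ζ Φ y = 0 := by simp [wavePressure, hz]
    refine ⟨by simp [waveVelocity, hz], ?_, hp⟩
    funext i j
    simp [waveStress, hz, hp]
  · have e1 : waveVelocity η ζ Φ y - (χ y * Real.cos (N * ℓ y) * amp) • η =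
        (dirDeriv (ζ, 0) (dirDeriv (ζ, 0) Φ) y - χ y * Real.cos (N * ℓ y) * amp) • η
          - dirDeriv (ζ, 0) (dirDeriv (η, 0) Φ) y • ζ := by
      rw [waveVelocity, sub_smul]; abel
    rw [e1]
    refine (norm_sub_le _ _).trans ?_
    rw [norm_smul, norm_smul, hη, hζ, mul_one, mul_one]
    refine (add_le_add (H₁ N hN y) (H₂ N hN y)).trans ?_
    rw [← add_div]
    exact hmono (by linarith)
  · have e1 : waveStress w η ζ Φ y - (χ y * Real.cos (N * ℓ y) * amp) • symProd w η =
        (dirDeriv (ζ, 0) (dirDeriv (ζ, 0) Φ) y - χ y * Real.cos (N * ℓ y) * amp) • symProd w η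
        - dirDeriv (ζ, 0) (dirDeriv (η, 0) Φ) y • symProd w ζ
        - dirDeriv (w, 1) (dirDeriv (ζ, 0) Φ) y • symProd ζ η
        + dirDeriv (w, 1) (dirDeriv (η, 0) Φ) y • symProd ζ ζ
        - fun i j => if i = j then wavePressure w η ζ Φ y else 0 := by
      funext i j
      simp only [waveStress, Pi.sub_apply, Pi.add_apply, Pi.smul_apply, smul_eq_mul]
      ring
    have e2 : ‖fun i j : Fin n => if i = j then wavePressure w η ζ Φ y else 0‖ ≤ K / N := by
      have hKN : 0 ≤ K / N := by positivity
      refine (pi_norm_le_iff_of_nonneg hKN).2 fun i => (pi_norm_le_iff_of_nonneg hKN).2 fun j => ?_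
      split_ifs
      · exact hpress y
      · simpa using hKN
    rw [e1]
    have b := fun (x C : ℝ) (M : Fin n → Fin n → ℝ) (h : |x| ≤ C / N) =>
      show ‖x • M‖ ≤ C * ‖M‖ / N by
        rw [norm_smul, mul_div_right_comm]
        exact mul_le_mul_of_nonneg_right h (norm_nonneg _)
    refine (norm_sub_le_of_le (norm_add_le_of_le (norm_sub_le_of_le (norm_sub_le_of_le
      (b _ _ _ (H₁ N hN y)) (b _ _ _ (H₂ N hN y))) (b _ _ _ (H₃ N hN y)))
      (b _ _ _ (H₄ N hN y))) e2).trans ?_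
    simp only [← add_div]
    exact hmono (by rw [hS]; linarith)
  · exact (hpress y).trans (hmono (by linarith))

/-! ### Geometry of the strict states -/

section Geometry

variable {n : ℕ}

/-- The quadratic form `c |z|² + u z · z - (v · z)²`. -/
noncomputable def defectForm (c : ℝ) (v : EuclideanSpace ℝ (Fin n)) (u : Fin n → Fin n → ℝ)
    (z : EuclideanSpace ℝ (Fin n)) : ℝ :=
  c * ‖z‖ ^ 2 + (∑ i, ∑ j, u i j * z i * z j) - (inner ℝ v z) ^ 2

/-- The states `(v, u)` with `v ⊗ v - u < c Id`. -/
def IsStrictState (c : ℝ) (v : EuclideanSpace ℝ (Fin n)) (u : Fin n → Fin n → ℝ) : Prop :=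
  ∀ z, z ≠ 0 → 0 < defectForm c v u z

theorem defectForm_smul (c : ℝ) (v : EuclideanSpace ℝ (Fin n)) (u : Fin n → Fin n → ℝ) (t : ℝ)
    (z : EuclideanSpace ℝ (Fin n)) : defectForm c v u (t • z) = t ^ 2 * defectForm c v u z := by
  have : ∑ i, ∑ j, u i j * (t • z) i * (t • z) j = t ^ 2 * ∑ i, ∑ j, u i j * z i * z j := by
    simp only [Finset.mul_sum, PiLp.smul_apply, smul_eq_mul]
    exact Finset.sum_congr rfl fun i _ => Finset.sum_congr rfl fun j _ => by ring
  rw [defectForm, defectForm, this, norm_smul, real_inner_smul_right, mul_pow, Real.norm_eq_abs,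
    sq_abs]
  ring

theorem isStrictState_iff_sphere (c : ℝ) (v : EuclideanSpace ℝ (Fin n)) (u : Fin n → Fin n → ℝ) :
    IsStrictState c v u ↔ ∀ z ∈ Metric.sphere (0 : EuclideanSpace ℝ (Fin n)) 1,
      0 < defectForm c v u z := by
  refine ⟨fun h z hz => h z (ne_zero_of_mem_unit_sphere ⟨z, hz⟩), fun h z hz => ?_⟩
  have hz0 : 0 < ‖z‖ := norm_pos_iff.2 hz
  have h1 := h (‖z‖⁻¹ • z) (by simp [norm_smul, hz0.ne'])
  rw [defectForm_smul] at h1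
  exact pos_of_mul_pos_right h1 (by positivity)

/-- By homogeneity positivity need only be tested on the unit sphere, whose compactness makes the
condition open. -/
theorem isOpen_setOf_isStrictState (c : ℝ) :
    IsOpen {s : EuclideanSpace ℝ (Fin n) × (Fin n → Fin n → ℝ) | IsStrictState c s.1 s.2} := by
  rw [isOpen_iff_mem_nhds]
  rintro s hs
  have hc : Continuous fun x : (EuclideanSpace ℝ (Fin n) × (Fin n → Fin n → ℝ)) ×
      EuclideanSpace ℝ (Fin n) => defectForm c x.1.1 x.1.2 x.2 := by
    unfold defectForm
    fun_prop
  have hs' := (isStrictState_iff_sphere c s.1 s.2).1 hs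
  have key : ∀ᶠ s' : EuclideanSpace ℝ (Fin n) × (Fin n → Fin n → ℝ) in nhds s,
      ∀ z ∈ Metric.sphere (0 : EuclideanSpace ℝ (Fin n)) 1, 0 < defectForm c s'.1 s'.2 z :=
    (isCompact_sphere _ _).eventually_forall_of_forall_eventually fun z hz =>
      (hc.tendsto (s, z)).eventually (lt_mem_nhds (hs' z hz))
  filter_upwards [key] with s' h
  exact (isStrictState_iff_sphere c s'.1 s'.2).2 h

theorem sum_symProd_mul_mul (a b z : EuclideanSpace ℝ (Fin n)) :
    ∑ i, ∑ j, symProd a b i j * z i * z j = 2 * (inner ℝ a z * inner ℝ b z) := by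
  simp only [PiLp.inner_apply, RCLike.inner_apply, conj_trivial, Finset.sum_mul_sum, symProd]
  have : ∑ i, ∑ j, b i * a j * z i * z j = ∑ i, ∑ j, a i * b j * z i * z j := by
    rw [Finset.sum_comm]
    exact Finset.sum_congr rfl fun i _ => Finset.sum_congr rfl fun j _ => by ring
  simp only [add_mul, Finset.sum_add_distrib, this]
  rw [← two_mul]
  congr 1
  exact Finset.sum_congr rfl fun i _ => Finset.sum_congr rfl fun j _ => by ring

/-- The change of `u` cancels the part of the cross term `v ⊗ η + η ⊗ v` that is transversal to `η`,
so only a multiple of `η ⊗ η` is left. -/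
theorem defectForm_segment (c : ℝ) (v η : EuclideanSpace ℝ (Fin n)) (u : Fin n → Fin n → ℝ)
    (τ : ℝ) (z : EuclideanSpace ℝ (Fin n)) :
    defectForm c (v + τ • η) (u + τ • symProd (v - (inner ℝ v η : ℝ) • η) η) z =
      defectForm c v u z - (2 * τ * inner ℝ v η + τ ^ 2) * (inner ℝ η z) ^ 2 := by
  have h : ∑ i, ∑ j, (u + τ • symProd (v - (inner ℝ v η : ℝ) • η) η) i j * z i * z j =
      (∑ i, ∑ j, u i j * z i * z j)
        + τ * ∑ i, ∑ j, symProd (v - (inner ℝ v η : ℝ) • η) η i j * z i * z j := by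
    simp only [Pi.add_apply, Pi.smul_apply, smul_eq_mul, add_mul, Finset.sum_add_distrib,
      Finset.mul_sum, mul_assoc]
  rw [defectForm, h, sum_symProd_mul_mul, defectForm, inner_add_left, inner_sub_left,
    real_inner_smul_left, real_inner_smul_left]
  ring

/-- The matrix of `defectForm`. -/
noncomputable def defectMatrix (c : ℝ) (v : EuclideanSpace ℝ (Fin n)) (u : Fin n → Fin n → ℝ) :
    Matrix (Fin n) (Fin n) ℝ :=
  Matrix.of fun i j => (if i = j then c else 0) + u i j - v i * v j

theorem defectForm_eq_dotProduct (c : ℝ) (v : EuclideanSpace ℝ (Fin n)) (u : Fin n → Fin n → ℝ)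
    (z : EuclideanSpace ℝ (Fin n)) :
    defectForm c v u z = dotProduct z.ofLp ((defectMatrix c v u).mulVec z.ofLp) := by
  have h1 : (inner ℝ v z : ℝ) ^ 2 = ∑ i, ∑ j, v i * v j * z i * z j := by
    rw [sq]
    simp only [PiLp.inner_apply, RCLike.inner_apply, conj_trivial, Finset.sum_mul_sum]
    exact Finset.sum_congr rfl fun i _ => Finset.sum_congr rfl fun j _ => by ring
  have h2 : c * ‖z‖ ^ 2 = ∑ i, ∑ j, (if i = j then c else 0) * z i * z j := by
    rw [EuclideanSpace.real_norm_sq_eq, Finset.mul_sum]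
    refine Finset.sum_congr rfl fun i _ => ?_
    simp only [ite_mul, zero_mul, Finset.sum_ite_eq, Finset.mem_univ, if_true]
    ring
  rw [defectForm, h1, h2]
  simp only [dotProduct, Matrix.mulVec, Finset.mul_sum, defectMatrix, Matrix.of_apply,
    ← Finset.sum_add_distrib, ← Finset.sum_sub_distrib]
  exact Finset.sum_congr rfl fun i _ => Finset.sum_congr rfl fun j _ => by ring

theorem trace_defectMatrix (c : ℝ) (v : EuclideanSpace ℝ (Fin n)) {u : Fin n → Fin n → ℝ}
    (hu : ∑ i, u i i = 0) : (defectMatrix c v u).trace = n * c - ‖v‖ ^ 2 := by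
  simp only [Matrix.trace, Matrix.diag, defectMatrix, Matrix.of_apply, if_true,
    Finset.sum_add_distrib, Finset.sum_sub_distrib, hu, EuclideanSpace.real_norm_sq_eq]
  simp [sq]

theorem defectMatrix_apply_self (c : ℝ) (v : EuclideanSpace ℝ (Fin n)) (u : Fin n → Fin n → ℝ)
    (i : Fin n) : defectMatrix c v u i i = defectForm c v u (EuclideanSpace.single i 1) := by
  rw [defectForm_eq_dotProduct]
  simp

theorem isHermitian_defectMatrix (c : ℝ) (v : EuclideanSpace ℝ (Fin n))
    {u : Fin n → Fin n → ℝ} (hu : ∀ i j, u i j = u j i) : (defectMatrix c v u).IsHermitian := by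
  ext i j
  simp only [defectMatrix, Matrix.conjTranspose_apply, Matrix.of_apply, star_trivial, hu i j,
    eq_comm (a := i)]
  ring

theorem IsStrictState.defectMatrix_diag_pos {c : ℝ} {v : EuclideanSpace ℝ (Fin n)}
    {u : Fin n → Fin n → ℝ} (h : IsStrictState c v u) (i : Fin n) : 0 < defectMatrix c v u i i := by
  rw [defectMatrix_apply_self]
  exact h _ (by simp)

theorem IsStrictState.norm_sq_le {c : ℝ} {v : EuclideanSpace ℝ (Fin n)}
    {u : Fin n → Fin n → ℝ} (h : IsStrictState c v u) (hu : ∑ i, u i i = 0) :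
    ‖v‖ ^ 2 ≤ n * c := by
  have := Finset.sum_nonneg fun i (_ : i ∈ Finset.univ) => (h.defectMatrix_diag_pos i).le
  have h2 := trace_defectMatrix c v hu
  rw [Matrix.trace] at h2
  simp only [Matrix.diag] at h2
  linarith

theorem IsStrictState.norm_sq_lt (hn : n ≠ 0) {c : ℝ} {v : EuclideanSpace ℝ (Fin n)}
    {u : Fin n → Fin n → ℝ} (h : IsStrictState c v u) (hu : ∑ i, u i i = 0) :
    ‖v‖ ^ 2 < n * c := by
  have := Finset.sum_pos (fun i (_ : i ∈ Finset.univ) => h.defectMatrix_diag_pos i)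
    ⟨⟨0, Nat.pos_of_ne_zero hn⟩, Finset.mem_univ _⟩
  have h2 := trace_defectMatrix c v hu
  rw [Matrix.trace] at h2
  simp only [Matrix.diag] at h2
  linarith

/-- The entries of a positive matrix are controlled by its trace. -/
theorem IsStrictState.abs_defectMatrix_le {c : ℝ} {v : EuclideanSpace ℝ (Fin n)}
    {u : Fin n → Fin n → ℝ} (h : IsStrictState c v u) (hs : ∀ i j, u i j = u j i)
    (hu : ∑ i, u i i = 0) (i j : Fin n) :
    |defectMatrix c v u i j| ≤ n * c - ‖v‖ ^ 2 := by
  have htr : ∀ k, defectMatrix c v u k k ≤ n * c - ‖v‖ ^ 2 := by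
    intro k
    rw [← trace_defectMatrix c v hu]
    exact Finset.single_le_sum (f := fun i => defectMatrix c v u i i)
      (fun i _ => (h.defectMatrix_diag_pos i).le) (Finset.mem_univ k)
  by_cases hij : i = j
  · subst hij
    rw [abs_of_pos (h.defectMatrix_diag_pos i)]
    exact htr i
  have hsym : defectMatrix c v u j i = defectMatrix c v u i j :=
    (isHermitian_defectMatrix c v hs).apply i j
  -- Test the form on `eᵢ + t eⱼ`; the values `t = ±1` bound the off-diagonal entry by the mean of
  -- two diagonal ones.
  have key : ∀ t : ℝ, 0 < defectMatrix c v u i i + 2 * t * defectMatrix c v u i j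
      + t ^ 2 * defectMatrix c v u j j := by
    intro t
    have hne : EuclideanSpace.single i (1 : ℝ) + t • EuclideanSpace.single j (1 : ℝ) ≠ 0 := by
      intro h0
      have := congrArg (fun z : EuclideanSpace ℝ (Fin n) => z i) h0
      simp [hij] at this
    have := h _ hne
    rw [defectForm_eq_dotProduct] at this
    simp only [WithLp.ofLp_add, WithLp.ofLp_smul, Matrix.mulVec_add, Matrix.mulVec_smul,
      add_dotProduct, dotProduct_add, smul_dotProduct, dotProduct_smul] at this
    simp [hsym] at this
    linarith
  have h1 := key 1
  have h2 := key (-1)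
  have := htr i
  have := htr j
  rw [abs_le]
  constructor <;> linarith

theorem exists_unit_orthogonal (hn : 2 ≤ n) (η : EuclideanSpace ℝ (Fin n)) :
    ∃ ζ : EuclideanSpace ℝ (Fin n), ‖ζ‖ = 1 ∧ inner ℝ η ζ = (0 : ℝ) := by
  have hne : (Submodule.span ℝ {η})ᗮ ≠ ⊥ := by
    intro h
    have h1 := Submodule.finrank_add_finrank_orthogonal (Submodule.span ℝ {η})
    rw [h, finrank_bot, finrank_euclideanSpace_fin] at h1
    have h2 := finrank_span_le_card (R := ℝ) ({η} : Set (EuclideanSpace ℝ (Fin n)))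
    simp only [Set.toFinset_singleton, Finset.card_singleton] at h2
    omega
  obtain ⟨b, hb, hb0⟩ := Submodule.exists_mem_ne_zero_of_ne_bot hne
  rw [Submodule.mem_orthogonal_singleton_iff_inner_right] at hb
  refine ⟨‖b‖⁻¹ • b, ?_, ?_⟩
  · rw [norm_smul, norm_inv, norm_norm, inv_mul_cancel₀ (norm_ne_zero_iff.2 hb0)]
  · rw [real_inner_smul_right, hb, mul_zero]

/-- Some eigenvalue is at least the average, trace over `n`. Subtracting less than this eigenvalue
in its own eigendirection leaves the form positive, since the orthogonal complement of `η` is not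
affected. -/
theorem IsStrictState.exists_eigenvector (hn : n ≠ 0) {c : ℝ} {v : EuclideanSpace ℝ (Fin n)}
    {u : Fin n → Fin n → ℝ} (h : IsStrictState c v u) (hs : ∀ i j, u i j = u j i)
    (hu : ∑ i, u i i = 0) :
    ∃ η : EuclideanSpace ℝ (Fin n), ‖η‖ = 1 ∧ ∀ μ < (n * c - ‖v‖ ^ 2) / n,
      ∀ z, z ≠ 0 → 0 < defectForm c v u z - μ * (inner ℝ η z) ^ 2 := by
  have hH := isHermitian_defectMatrix c v hs
  have hn0 : (0 : ℝ) < n := by exact_mod_cast Nat.pos_of_ne_zero hn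
  obtain ⟨k, hk⟩ : ∃ k, (n * c - ‖v‖ ^ 2) / n ≤ hH.eigenvalues k := by
    by_contra! hlt
    have h1 := hH.trace_eq_sum_eigenvalues
    rw [trace_defectMatrix c v hu] at h1
    have h2 := Finset.sum_lt_sum_of_nonempty (s := (Finset.univ : Finset (Fin n)))
      ⟨⟨0, Nat.pos_of_ne_zero hn⟩, Finset.mem_univ _⟩ fun i _ => hlt i
    rw [Finset.sum_const, Finset.card_univ, Fintype.card_fin, nsmul_eq_mul,
      mul_div_cancel₀ _ hn0.ne'] at h2
    simp only [RCLike.ofReal_real_eq_id, id] at h1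
    linarith
  set η := hH.eigenvectorBasis k with hη
  have hη1 : ‖η‖ = 1 := hH.eigenvectorBasis.orthonormal.1 k
  refine ⟨η, hη1, fun μ hμ z hz => ?_⟩
  set t : ℝ := inner ℝ η z with ht
  set z' := z - t • η with hz'
  have horth : inner ℝ η z' = (0 : ℝ) := by
    rw [hz', inner_sub_right, real_inner_smul_right, real_inner_self_eq_norm_sq, hη1]
    simp [ht]
  have hzz : z = t • η + z' := by rw [hz']; abel
  have hdot : ∀ x y : EuclideanSpace ℝ (Fin n), dotProduct x.ofLp y.ofLp = inner ℝ x y := by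
    intro x y
    simp only [dotProduct, PiLp.inner_apply, RCLike.inner_apply, conj_trivial, mul_comm]
  have hev : (defectMatrix c v u).mulVec η.ofLp = hH.eigenvalues k • η.ofLp :=
    hH.mulVec_eigenvectorBasis k
  have hform : defectForm c v u z = hH.eigenvalues k * t ^ 2 + defectForm c v u z' := by
    have hcross : dotProduct η.ofLp ((defectMatrix c v u).mulVec z'.ofLp) = 0 := by
      rw [Matrix.dotProduct_mulVec, ← Matrix.mulVec_transpose]
      have : (defectMatrix c v u).transpose = defectMatrix c v u := by
        simpa [Matrix.IsHermitian, Matrix.conjTranspose_eq_transpose_of_trivial] using hH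
      rw [this, hev, smul_dotProduct, hdot, horth, smul_zero]
    rw [defectForm_eq_dotProduct, defectForm_eq_dotProduct]
    conv_lhs => rw [hzz]
    simp only [WithLp.ofLp_add, WithLp.ofLp_smul, Matrix.mulVec_add, Matrix.mulVec_smul,
      add_dotProduct, dotProduct_add, smul_dotProduct, dotProduct_smul, hcross, hev]
    rw [hdot η η, hdot z' η, real_inner_comm η z', horth, real_inner_self_eq_norm_sq, hη1]
    simp only [smul_eq_mul]
    ring
  rw [hform]
  by_cases hz0 : z' = 0
  · have ht0 : t ≠ 0 := by
      rintro h0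
      rw [hz0, h0] at hzz
      exact hz (by simpa using hzz)
    have : 0 < (hH.eigenvalues k - μ) * t ^ 2 :=
      mul_pos (by linarith) (by positivity)
    have h0 : defectForm c v u z' = 0 := by simp [hz0, defectForm]
    rw [h0]
    linarith
  · have := h z' hz0
    have : 0 ≤ (hH.eigenvalues k - μ) * t ^ 2 := mul_nonneg (by linarith) (by positivity)
    linarith

/-- Through every strict state there is a segment of strict states in a wave direction, whose
length is controlled by the energy defect. -/
theorem IsStrictState.exists_segment (hn : 2 ≤ n) {c : ℝ} (hc : 0 < c)
    {v : EuclideanSpace ℝ (Fin n)} {u : Fin n → Fin n → ℝ} (h : IsStrictState c v u)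
    (hs : ∀ i j, u i j = u j i) (hu : ∑ i, u i i = 0) :
    ∃ η ζ : EuclideanSpace ℝ (Fin n), ‖η‖ = 1 ∧ ‖ζ‖ = 1 ∧ inner ℝ η ζ = (0 : ℝ) ∧
      ∀ s ∈ Set.Icc (-1 : ℝ) 1,
        IsStrictState c (v + (s * ((n * c - ‖v‖ ^ 2) / (4 * n * √(n * c)))) • η)
          (u + (s * ((n * c - ‖v‖ ^ 2) / (4 * n * √(n * c)))) •
            symProd (v - (inner ℝ v η : ℝ) • η) η) := by
  have hn0 : n ≠ 0 := by omega
  have hnpos : (0 : ℝ) < n := by exact_mod_cast Nat.pos_of_ne_zero hn0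
  have hn2 : (2 : ℝ) ≤ n := by exact_mod_cast hn
  obtain ⟨η, hη, hev⟩ := h.exists_eigenvector hn0 hs hu
  obtain ⟨ζ, hζ, hηζ⟩ := exists_unit_orthogonal hn η
  refine ⟨η, ζ, hη, hζ, hηζ, fun s hs1 z hz => ?_⟩
  rw [defectForm_segment]
  refine hev _ ?_ z hz
  have hlt := h.norm_sq_lt hn0 hu
  set r := √(n * c) with hr
  have hr0 : 0 < r := Real.sqrt_pos.2 (by positivity)
  have hrsq : r ^ 2 = n * c := Real.sq_sqrt (by positivity)
  rw [← hrsq] at hlt ⊢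
  set m := r ^ 2 - ‖v‖ ^ 2 with hm
  have hm0 : 0 < m := by linarith
  have hmr : m ≤ r ^ 2 := by have := sq_nonneg ‖v‖; linarith
  -- With this length `2 a r = m / (2 n)`, while `a² < m / (2 n)` because `m ≤ r²`. The linear and
  -- quadratic terms together stay below the admissible `m / n`.
  set a := m / (4 * n * r) with ha
  have ha0 : 0 < a := by positivity
  have hvr : ‖v‖ ≤ r := le_of_abs_le (abs_le_of_sq_le_sq hlt.le hr0.le)
  have hvη : |(inner ℝ v η : ℝ)| ≤ r := by
    have := abs_real_inner_le_norm v η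
    rw [hη, mul_one] at this
    linarith
  have hsabs : |s| ≤ 1 := abs_le.2 hs1
  have e1 : 2 * (s * a) * inner ℝ v η ≤ 2 * a * r := by
    have : s * (inner ℝ v η : ℝ) ≤ 1 * r :=
      (le_abs_self _).trans (by rw [abs_mul]; exact mul_le_mul hsabs hvη (abs_nonneg _) zero_le_one)
    nlinarith
  have e2 : (s * a) ^ 2 ≤ a ^ 2 := by
    rw [mul_pow]
    have : s ^ 2 ≤ 1 := (sq_le_one_iff_abs_le_one s).2 hsabs
    nlinarith [sq_nonneg a]
  have e3 : 2 * a * r = m / n / 2 := by rw [ha]; field_simp; ring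
  have e4 : a ^ 2 < m / n / 2 := by
    rw [ha, div_pow, div_div, div_lt_div_iff₀ (by positivity) (by positivity)]
    have h1 : m ^ 2 ≤ m * r ^ 2 := by nlinarith
    have h2 : m * r ^ 2 * (n * 2) < m * (4 * n * r) ^ 2 := by
      have h3 : 0 < m * r ^ 2 * n := by positivity
      nlinarith
    nlinarith
  linarith

end Geometry

/-- The constant of the relative energy gain. -/
noncomputable def gainConstant (n : ℕ) (c : ℝ) : ℝ :=
  (1 / (4 * n * √(n * c))) ^ 2 / 4 * (1 / 2) ^ (n + 1)

theorem gainConstant_pos {n : ℕ} (hn : n ≠ 0) {c : ℝ} (hc : 0 < c) : 0 < gainConstant n c := by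
  have : (0 : ℝ) < n := by exact_mod_cast Nat.pos_of_ne_zero hn
  unfold gainConstant
  positivity

theorem measureReal_closedBall_half {n : ℕ} (y : SpaceTime n) {ρ : ℝ} (hρ : 0 < ρ) :
    volume.real (Metric.closedBall y (ρ / 2)) =
      (1 / 2) ^ (n + 1) * volume.real (Metric.closedBall y ρ) := by
  have hd : Module.finrank ℝ (SpaceTime n) = n + 1 := by simp [SpaceTime]
  rw [Measure.real, Measure.real, Measure.addHaar_closedBall _ _ (by positivity : 0 ≤ ρ / 2),
    Measure.addHaar_closedBall _ _ hρ.le, hd, ENNReal.toReal_mul, ENNReal.toReal_mul,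
    ENNReal.toReal_ofReal (by positivity), ENNReal.toReal_ofReal (by positivity)]
  rw [div_pow, one_div_pow]
  ring

/-! ### Oscillating integrals and the perturbation on one ball -/

section OscillatingIntegrals

variable {n : ℕ}

theorem abs_integral_inner_le {B : Set (SpaceTime n)} (hB : IsCompact B)
    {d g : SpaceTime n → EuclideanSpace ℝ (Fin n)} {η : EuclideanSpace ℝ (Fin n)}
    {f : SpaceTime n → ℝ} {κ Γ : ℝ}
    (hd : Continuous d) (hg : Continuous g) (hf : Continuous f)
    (hdB : ∀ y ∉ B, d y = 0) (hfB : ∀ y ∉ B, f y = 0) (hΓ : ∀ y ∈ B, ‖g y‖ ≤ Γ)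
    (hκ : ∀ y, ‖d y - f y • η‖ ≤ κ) :
    |∫ y, inner ℝ (d y) (g y)| ≤
      |∫ y, f y * inner ℝ η (g y)| + κ * Γ * volume.real B := by
  have hI1 : Integrable (fun y => (inner ℝ (d y) (g y) : ℝ)) :=
    (hd.inner hg).integrable_of_hasCompactSupport
      (HasCompactSupport.intro hB fun y hy => by simp [hdB y hy])
  have hI2 : Integrable (fun y => f y * (inner ℝ η (g y) : ℝ)) :=
    (hf.mul (continuous_const.inner hg)).integrable_of_hasCompactSupport
      (HasCompactSupport.intro hB fun y hy => by simp [hfB y hy])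
  have h1 : |(∫ y, inner ℝ (d y) (g y)) - ∫ y, f y * inner ℝ η (g y)| ≤
      κ * Γ * volume.real B := by
    rw [← integral_sub hI1 hI2, ← setIntegral_eq_integral_of_forall_compl_eq_zero (s := B)
      (fun y hy => by simp [hdB y hy, hfB y hy])]
    rw [← Real.norm_eq_abs]
    refine norm_setIntegral_le_of_norm_le_const hB.measure_lt_top fun y hy => ?_
    rw [← real_inner_smul_left, ← inner_sub_left]
    refine (norm_inner_le_norm _ _).trans ?_
    exact mul_le_mul (hκ y) (hΓ y hy) (norm_nonneg _) ((norm_nonneg _).trans (hκ y))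
  have h2 := abs_sub_abs_le_abs_sub (∫ y, inner ℝ (d y) (g y)) (∫ y, f y * inner ℝ η (g y))
  linarith

/-- Expand the square of `d = f η + (d - f η)` and discard the nonnegative square of the error. -/
theorem le_integral_norm_sq {B : Set (SpaceTime n)} (hB : IsCompact B)
    {d : SpaceTime n → EuclideanSpace ℝ (Fin n)} {η : EuclideanSpace ℝ (Fin n)} (hη : ‖η‖ = 1)
    {f : SpaceTime n → ℝ} {κ a : ℝ} (hd : Continuous d) (hf : Continuous f)
    (hdB : ∀ y ∉ B, d y = 0) (hfB : ∀ y ∉ B, f y = 0) (hfa : ∀ y, |f y| ≤ a)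
    (hκ : ∀ y, ‖d y - f y • η‖ ≤ κ) :
    (∫ y, f y ^ 2) - 2 * a * κ * volume.real B ≤ ∫ y, ‖d y‖ ^ 2 := by
  have hI : ∀ {h : SpaceTime n → ℝ}, Continuous h → IntegrableOn h B :=
    fun hh => hh.continuousOn.integrableOn_compact hB
  rw [← setIntegral_eq_integral_of_forall_compl_eq_zero (s := B) (f := fun y => f y ^ 2)
    (fun y hy => by simp [hfB y hy]),
    ← setIntegral_eq_integral_of_forall_compl_eq_zero (s := B) (f := fun y => ‖d y‖ ^ 2)
    (fun y hy => by simp [hdB y hy])]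
  have hconst : 2 * a * κ * volume.real B = ∫ _ in B, 2 * a * κ := by
    rw [setIntegral_const, smul_eq_mul, mul_comm]
  rw [hconst, ← integral_sub (hI (h := fun y => f y ^ 2) (by fun_prop)) (hI continuous_const)]
  refine setIntegral_mono (hI (by fun_prop)) (hI (by fun_prop)) fun y => ?_
  have h1 : ‖d y‖ ^ 2 = f y ^ 2 + 2 * inner ℝ (f y • η) (d y - f y • η)
      + ‖d y - f y • η‖ ^ 2 := by
    have := norm_add_sq_real (f y • η) (d y - f y • η)
    rw [add_sub_cancel, norm_smul, hη, mul_one, Real.norm_eq_abs, sq_abs] at this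
    exact this
  have h2 : |(inner ℝ (f y • η) (d y - f y • η) : ℝ)| ≤ a * κ := by
    refine (abs_real_inner_le_norm _ _).trans ?_
    rw [norm_smul, hη, mul_one]
    exact mul_le_mul (hfa y) (hκ y) (norm_nonneg _) ((abs_nonneg _).trans (hfa y))
  have h3 := (abs_le.1 h2).1
  have h4 := sq_nonneg ‖d y - f y • η‖
  simp only
  linarith

/-- Since `cos² s = (1 + cos 2s) / 2`, the oscillating half disappears by Riemann–Lebesgue. -/
theorem tendsto_integral_cos_sq {χ : SpaceTime n → ℝ} (hχ : Continuous χ)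
    (hχc : HasCompactSupport χ) {ℓ : SpaceTime n →L[ℝ] ℝ} (hℓ : ℓ ≠ 0) (a : ℝ) :
    Filter.Tendsto (fun N : ℝ => ∫ y, (χ y * Real.cos (N * ℓ y) * a) ^ 2) Filter.atTop
      (nhds (a ^ 2 / 2 * ∫ y, χ y ^ 2)) := by
  have hi : Integrable (fun y => a ^ 2 / 2 * χ y ^ 2) :=
    (continuous_const.mul (hχ.pow 2)).integrable_of_hasCompactSupport
      (HasCompactSupport.intro hχc fun y hy => by simp [image_eq_zero_of_notMem_tsupport hy])
  have h := (tendsto_integral_cos_mul volume hℓ hi).comp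
    (Filter.tendsto_id.const_mul_atTop (zero_lt_two (α := ℝ)))
  have h2 := h.const_add (∫ y, a ^ 2 / 2 * χ y ^ 2)
  rw [add_zero, integral_const_mul] at h2
  refine h2.congr fun N => ?_
  simp only [Function.comp_apply, id]
  rw [← integral_const_mul, ← integral_add hi]
  · refine integral_congr_ae (Filter.Eventually.of_forall fun y => ?_)
    simp only
    rw [show 2 * N * ℓ y = 2 * (N * ℓ y) by ring, Real.cos_two_mul]
    ring
  · have hℓc := ℓ.continuous
    refine Continuous.integrable_of_hasCompactSupport (by fun_prop)
      (HasCompactSupport.intro hχc fun y hy => by simp [image_eq_zero_of_notMem_tsupport hy])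

end OscillatingIntegrals

/-- The pair `(v, u)` can be perturbed in the set `B` by solutions of the linear system that are
almost orthogonal to finitely many prescribed fields and have energy at least `G`. -/
def IsPerturbable {n : ℕ} (c : ℝ) (v : SpaceTime n → EuclideanSpace ℝ (Fin n))
    (u : SpaceTime n → Fin n → Fin n → ℝ) (B : Set (SpaceTime n)) (G : ℝ) : Prop :=
  ∀ T : Set (SpaceTime n → EuclideanSpace ℝ (Fin n)), T.Finite → (∀ g ∈ T, Continuous g) →
    ∀ ε > 0, ∃ (d : SpaceTime n → EuclideanSpace ℝ (Fin n)) (e : SpaceTime n → Fin n → Fin n → ℝ)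
      (p : SpaceTime n → ℝ), IsLinearEulerSolution d e p ∧
      (∀ y ∉ B, d y = 0 ∧ e y = 0 ∧ p y = 0) ∧
      (∀ y ∈ B, IsStrictState c (v y + d y) (u y + e y)) ∧
      (∀ y, |p y| ≤ ε) ∧ (∀ g ∈ T, |∫ y, inner ℝ (d y) (g y)| ≤ ε) ∧ G ≤ ∫ y, ‖d y‖ ^ 2

/-- Near any point, a strict state can be perturbed on small balls by a fast oscillating wave. -/
theorem exists_isPerturbable_closedBall {n : ℕ} (hn : 2 ≤ n) {c : ℝ} (hc : 0 < c)
    {v : SpaceTime n → EuclideanSpace ℝ (Fin n)} {u : SpaceTime n → Fin n → Fin n → ℝ}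
    (hv : Continuous v) (hu : Continuous u) (y₀ : SpaceTime n)
    (hs : ∀ i j, u y₀ i j = u y₀ j i) (htr : ∑ i, u y₀ i i = 0)
    (h₀ : IsStrictState c (v y₀) (u y₀)) :
    ∃ δ > 0, ∀ ρ, 0 < ρ → ρ < δ → IsPerturbable c v u (Metric.closedBall y₀ ρ)
      (gainConstant n c * (n * c - ‖v y₀‖ ^ 2) ^ 2 * volume.real (Metric.closedBall y₀ ρ)) := by
  have hn0 : n ≠ 0 := by omega
  have hnpos : (0 : ℝ) < n := by exact_mod_cast Nat.pos_of_ne_zero hn0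
  obtain ⟨η, ζ, hη, hζ, hηζ, hseg⟩ := h₀.exists_segment hn hc hs htr
  have hm0 : 0 < n * c - ‖v y₀‖ ^ 2 := by linarith [h₀.norm_sq_lt hn0 htr]
  set m := n * c - ‖v y₀‖ ^ 2 with hm
  set a := m / (4 * n * √(n * c)) with ha
  have ha0 : 0 < a := by positivity
  set M := symProd (v y₀ - (inner ℝ (v y₀) η : ℝ) • η) η with hM
  let K : Set (EuclideanSpace ℝ (Fin n) × (Fin n → Fin n → ℝ)) :=
    (fun s : ℝ => (v y₀ + (s * a) • η, u y₀ + (s * a) • M)) '' Set.Icc (-1) 1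
  have hKc : IsCompact K := isCompact_Icc.image (by fun_prop)
  have hKO : K ⊆ {s | IsStrictState c s.1 s.2} := by
    rintro _ ⟨s, hs, rfl⟩
    exact hseg s hs
  -- The compact segment has a whole `τ`-neighbourhood of strict states. Half of `τ` is spent on the
  -- variation of `(v, u)` over the ball, half on the `C / N` error of the wave.
  obtain ⟨τ, hτ, hτK⟩ := hKc.exists_thickening_subset_open (isOpen_setOf_isStrictState c) hKO
  obtain ⟨δ, hδ, hδv⟩ := Metric.continuous_iff.1 (hv.prodMk hu) y₀ (τ / 2) (half_pos hτ)
  refine ⟨δ, hδ, fun ρ hρ hρδ T hT hTc ε hε => ?_⟩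
  let χ : ContDiffBump y₀ := ⟨ρ / 2, ρ, half_pos hρ, half_lt_self hρ⟩
  set B := Metric.closedBall y₀ ρ with hB
  have hBc : IsCompact B := isCompact_closedBall _ _
  have hχs : tsupport χ = B := χ.tsupport_eq
  have hχB : ∀ y ∉ B, χ y = 0 := fun y hy => image_eq_zero_of_notMem_tsupport (by rwa [hχs])
  obtain ⟨ℓ, hℓ, C, hC, hwave⟩ := exists_localized_wave hn0 (v y₀) hη hζ hηζ a
    χ.contDiff χ.hasCompactSupport
  have hb : ∀ g ∈ T, ∃ Γ, ∀ y ∈ B, ‖g y‖ ≤ Γ := fun g hg =>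
    hBc.exists_bound_of_continuousOn (hTc g hg).continuousOn
  have hCN : ∀ k : ℝ, Filter.Tendsto (fun N : ℝ => C / N * k) Filter.atTop (nhds 0) := by
    intro k
    simpa using (tendsto_const_nhds (x := C)).div_atTop Filter.tendsto_id |>.mul_const k
  have hT1 : ∀ᶠ N : ℝ in Filter.atTop, ∀ g ∈ T,
      ∃ Γ, (∀ y ∈ B, ‖g y‖ ≤ Γ) ∧ |∫ y, χ y * Real.cos (N * ℓ y) * a * inner ℝ η (g y)|
        + C / N * Γ * volume.real B ≤ ε := by
    rw [Filter.eventually_all_finite hT]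
    intro g hg
    obtain ⟨Γ, hΓ⟩ := hb g hg
    have hgc := hTc g hg
    have hi : Integrable (fun y => χ y * a * (inner ℝ η (g y) : ℝ)) :=
      ((χ.continuous.mul continuous_const).mul (continuous_const.inner
        hgc)).integrable_of_hasCompactSupport
        (HasCompactSupport.intro hBc fun y hy => by simp [hχB y hy])
    have h1 := (tendsto_integral_cos_mul volume hℓ hi).abs.add (hCN (Γ * volume.real B))
    simp only [abs_zero, add_zero] at h1
    filter_upwards [h1.eventually (gt_mem_nhds hε)] with N hN
    refine ⟨Γ, hΓ, hN.le.trans' (le_of_eq ?_)⟩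
    rw [mul_assoc (C / N)]
    congr 3
    funext y
    ring
  have hchi2 : volume.real (Metric.closedBall y₀ (ρ / 2)) ≤ ∫ y, χ y ^ 2 := by
    have hint : Integrable (fun y => χ y ^ 2) :=
      (χ.continuous.pow 2).integrable_of_hasCompactSupport
        (HasCompactSupport.intro hBc fun y hy => by simp [hχB y hy])
    calc volume.real (Metric.closedBall y₀ (ρ / 2))
        = ∫ y in Metric.closedBall y₀ (ρ / 2), (1 : ℝ) := by simp
      _ = ∫ y in Metric.closedBall y₀ (ρ / 2), χ y ^ 2 :=
          setIntegral_congr_fun Metric.isClosed_closedBall.measurableSet fun y hy => by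
            simp [χ.one_of_mem_closedBall hy]
      _ ≤ ∫ y, χ y ^ 2 := setIntegral_le_integral hint
          (Filter.Eventually.of_forall fun y => sq_nonneg _)
  have hvol : 0 < volume.real B :=
    ENNReal.toReal_pos (Metric.measure_closedBall_pos _ _ hρ).ne' hBc.measure_lt_top.ne
  have hT2 : ∀ᶠ N : ℝ in Filter.atTop, gainConstant n c * m ^ 2 * volume.real B ≤
      (∫ y, (χ y * Real.cos (N * ℓ y) * a) ^ 2) - 2 * a * (C / N) * volume.real B := by
    have h1 := (tendsto_integral_cos_sq χ.continuous χ.hasCompactSupport hℓ a).sub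
      (hCN (2 * a * volume.real B))
    rw [sub_zero] at h1
    -- Origin of `gainConstant`: `a² / m²`, times `1/2` for the mean of `cos²`, times `1/2` to make
    -- the inequality strict, times `(1/2)^(n+1)` for the half ball on which `χ = 1`.
    have hlt : gainConstant n c * m ^ 2 * volume.real B < a ^ 2 / 2 * ∫ y, χ y ^ 2 := by
      have e1 : gainConstant n c * m ^ 2 * volume.real B =
          a ^ 2 / 4 * volume.real (Metric.closedBall y₀ (ρ / 2)) := by
        rw [measureReal_closedBall_half y₀ hρ, ha, gainConstant]
        ring
      have e2 : 0 < volume.real (Metric.closedBall y₀ (ρ / 2)) := by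
        rw [measureReal_closedBall_half y₀ hρ]
        positivity
      rw [e1]
      have : 0 < a ^ 2 := by positivity
      nlinarith
    filter_upwards [h1.eventually (lt_mem_nhds hlt)] with N hN
    linarith
  have hT3 : ∀ᶠ N : ℝ in Filter.atTop, C / N < min (τ / 2) ε := by
    have := hCN 1
    simp only [mul_one] at this
    exact this.eventually (gt_mem_nhds (lt_min (half_pos hτ) hε))
  obtain ⟨N, hN1, hN2, hN3, hN4⟩ :=
    (hT1.and (hT2.and (hT3.and (Filter.eventually_ge_atTop 1)))).exists
  obtain ⟨d, e, p, hsol, hsupp, hest⟩ := hwave N hN4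
  rw [hχs] at hsupp
  have hℓc := ℓ.continuous
  have hχc := χ.continuous
  have hfc : Continuous fun y => χ y * Real.cos (N * ℓ y) * a := by fun_prop
  have hs1 : ∀ y, |χ y * Real.cos (N * ℓ y)| ≤ 1 := fun y => by
    rw [abs_mul]
    exact mul_le_one₀ (by rw [abs_of_nonneg χ.nonneg]; exact χ.le_one) (abs_nonneg _)
      (Real.abs_cos_le_one _)
  refine ⟨d, e, p, hsol, hsupp, fun y hy => ?_, fun y => ?_, fun g hg => ?_, ?_⟩
  · refine hτK (a := (v y + d y, u y + e y)) ?_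
    rw [Metric.mem_thickening_iff]
    refine ⟨_, ⟨χ y * Real.cos (N * ℓ y), abs_le.1 (hs1 y), rfl⟩, ?_⟩
    have h1 := hδv y (lt_of_le_of_lt hy hρδ)
    rw [dist_eq_norm] at h1 ⊢
    have h2 : ‖(d y - (χ y * Real.cos (N * ℓ y) * a) • η,
        e y - (χ y * Real.cos (N * ℓ y) * a) • M)‖ < τ / 2 := by
      rw [Prod.norm_mk]
      exact (max_le (hest y).1 (hest y).2.1).trans_lt (hN3.trans_le (min_le_left _ _))
    have h3 : ((v y + d y, u y + e y) : EuclideanSpace ℝ (Fin n) × (Fin n → Fin n → ℝ))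
        - (v y₀ + (χ y * Real.cos (N * ℓ y) * a) • η, u y₀ + (χ y * Real.cos (N * ℓ y) * a) • M) =
        ((v y, u y) - (v y₀, u y₀)) + (d y - (χ y * Real.cos (N * ℓ y) * a) • η,
        e y - (χ y * Real.cos (N * ℓ y) * a) • M) := by
      ext : 1
      · simp only [Prod.fst_sub, Prod.fst_add]; abel
      · simp only [Prod.snd_sub, Prod.snd_add]; abel
    rw [h3]
    refine (norm_add_le _ _).trans_lt ?_
    linarith
  · exact (hest y).2.2.trans (hN3.le.trans (min_le_right _ _))
  · obtain ⟨Γ, hΓ, hle⟩ := hN1 g hg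
    exact (abs_integral_inner_le hBc hsol.continuous_velocity (hTc g hg) hfc
      (fun y hy => (hsupp y hy).1) (fun y hy => by simp [hχB y hy]) hΓ
      fun y => (hest y).1).trans hle
  · exact hN2.trans (le_integral_norm_sq hBc hη hsol.continuous_velocity hfc
      (fun y hy => (hsupp y hy).1) (fun y hy => by simp [hχB y hy])
      (fun y => by
        rw [abs_mul, abs_of_pos ha0]
        exact mul_le_of_le_one_left ha0.le (hs1 y)) fun y => (hest y).1)

/-- Solutions of the linear system supported in `Q` whose values are strict states. -/
structure IsSubsolution {n : ℕ} (Q : Set (SpaceTime n)) (c : ℝ)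
    (v : SpaceTime n → EuclideanSpace ℝ (Fin n)) (u : SpaceTime n → Fin n → Fin n → ℝ)
    (q : SpaceTime n → ℝ) : Prop extends IsLinearEulerSolution v u q where
  eq_zero : ∀ y ∉ Q, v y = 0 ∧ u y = 0 ∧ q y = 0
  strict : ∀ y, IsStrictState c (v y) (u y)

/-! ### One step of the iteration: energy gain on `Q` -/

section Step

variable {n : ℕ} {Q : Set (SpaceTime n)} {c : ℝ}

theorem isSubsolution_zero (Q : Set (SpaceTime n)) (hc : 0 < c) :
    IsSubsolution Q c (0 : SpaceTime n → EuclideanSpace ℝ (Fin n)) 0 0 where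
  toIsLinearEulerSolution := IsLinearEulerSolution.zero
  eq_zero := by simp
  strict y z hz := by
    have : 0 < ‖z‖ := norm_pos_iff.2 hz
    simp only [defectForm, Pi.zero_apply, zero_mul, Finset.sum_const_zero, inner_zero_left]
    have := mul_pos hc (pow_pos this 2)
    linarith

theorem IsLinearEulerSolution.integrable_norm_sq {v : SpaceTime n → EuclideanSpace ℝ (Fin n)}
    {u : SpaceTime n → Fin n → Fin n → ℝ} {q : SpaceTime n → ℝ}
    (h : IsLinearEulerSolution v u q) : Integrable (fun y => ‖v y‖ ^ 2) :=
  (h.continuous_velocity.norm.pow 2).integrable_of_hasCompactSupport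
    (HasCompactSupport.intro h.compact_velocity fun y hy => by
      simp [image_eq_zero_of_notMem_tsupport hy])

theorem IsLinearEulerSolution.integrable_inner {v g : SpaceTime n → EuclideanSpace ℝ (Fin n)}
    {u : SpaceTime n → Fin n → Fin n → ℝ} {q : SpaceTime n → ℝ}
    (h : IsLinearEulerSolution v u q) (hg : Continuous g) :
    Integrable (fun y => (inner ℝ (v y) (g y) : ℝ)) :=
  (h.continuous_velocity.inner hg).integrable_of_hasCompactSupport
    (HasCompactSupport.intro h.compact_velocity fun y hy => by
      simp [image_eq_zero_of_notMem_tsupport hy])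

theorem IsLinearEulerSolution.integral_norm_add_sq {v v' : SpaceTime n → EuclideanSpace ℝ (Fin n)}
    {u u' : SpaceTime n → Fin n → Fin n → ℝ} {q q' : SpaceTime n → ℝ}
    (h : IsLinearEulerSolution v u q) (h' : IsLinearEulerSolution v' u' q') :
    ∫ y, ‖v y + v' y‖ ^ 2 =
      (∫ y, ‖v y‖ ^ 2) + 2 * (∫ y, inner ℝ (v' y) (v y)) + ∫ y, ‖v' y‖ ^ 2 := by
  have hi := (h'.integrable_inner h.continuous_velocity).const_mul 2
  have hi' : Integrable (fun y => ‖v y‖ ^ 2 + 2 * (inner ℝ (v' y) (v y) : ℝ)) :=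
    h.integrable_norm_sq.add hi
  rw [← integral_const_mul, ← integral_add h.integrable_norm_sq hi,
    ← integral_add hi' h'.integrable_norm_sq]
  refine integral_congr_ae (Filter.Eventually.of_forall fun y => ?_)
  simp only
  rw [norm_add_sq_real, real_inner_comm]

/-- Perturbations on disjoint sets do not interact: on each set the field met there is still the
original one, so strictness persists and the pressure errors do not add up. Only the integral errors
accumulate with the number of sets. -/
theorem IsSubsolution.exists_perturbation_finset
    {v : SpaceTime n → EuclideanSpace ℝ (Fin n)} {u : SpaceTime n → Fin n → Fin n → ℝ}
    {q : SpaceTime n → ℝ} (h : IsSubsolution Q c v u q) {ι : Type*} (B : ι → Set (SpaceTime n))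
    (G : ι → ℝ) (hBQ : ∀ i, B i ⊆ Q) (hdisj : Pairwise (Function.onFun Disjoint B))
    (hB : ∀ i, IsPerturbable c v u (B i) (G i))
    {T : Set (SpaceTime n → EuclideanSpace ℝ (Fin n))} (hT : T.Finite)
    (hTc : ∀ g ∈ T, Continuous g) {ε : ℝ} (hε : 0 < ε) (s : Finset ι) :
    ∃ (v' : SpaceTime n → EuclideanSpace ℝ (Fin n)) (u' : SpaceTime n → Fin n → Fin n → ℝ)
      (q' : SpaceTime n → ℝ), IsSubsolution Q c v' u' q' ∧
      (∀ y, (∀ i ∈ s, y ∉ B i) → v' y = v y ∧ u' y = u y ∧ q' y = q y) ∧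
      (∀ y, |q' y - q y| ≤ ε) ∧
      (∀ g ∈ T, |∫ y, inner ℝ (v' y - v y) (g y)| ≤ s.card * ε) ∧
      (∫ y, ‖v y‖ ^ 2) + ∑ i ∈ s, G i - 2 * s.card * ε ≤ ∫ y, ‖v' y‖ ^ 2 := by
  classical
  induction s using Finset.induction_on with
  | empty => exact ⟨v, u, q, h, by simp, by simp [hε.le], by simp, by simp⟩
  | insert b s hb ih =>
    obtain ⟨v', u', q', h', heq, hq, hg, hE⟩ := ih
    -- Adding `v` to the test fields controls the cross term of the energy; on the support of `d`
    -- the current velocity `v'` equals `v`.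
    obtain ⟨d, e, p, hd, hd0, hstr, hp, horth, hgain⟩ := hB b (insert v T) (hT.insert v)
      (by
        rintro g (rfl | hg)
        exacts [h.continuous_velocity, hTc g hg]) ε hε
    have hbs : ∀ y ∈ B b, ∀ i ∈ s, y ∉ B i := fun y hy i hi hyi =>
      Set.disjoint_left.1 (hdisj (show b ≠ i by rintro rfl; exact hb hi)) hy hyi
    refine ⟨v' + d, u' + e, q' + p, ⟨h'.toIsLinearEulerSolution.add hd, ?_, ?_⟩, ?_, ?_, ?_, ?_⟩
    · intro y hy
      have h1 := h'.eq_zero y hy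
      have h2 := hd0 y fun hyb => hy (hBQ b hyb)
      simp [h1, h2]
    · intro y
      by_cases hy : y ∈ B b
      · have h1 := heq y (hbs y hy)
        simp only [Pi.add_apply v', Pi.add_apply u', h1]
        exact hstr y hy
      · have h2 := hd0 y hy
        simp only [Pi.add_apply v', Pi.add_apply u', h2, add_zero]
        exact h'.strict y
    · intro y hy
      have h1 := heq y fun i hi => hy i (Finset.mem_insert_of_mem hi)
      have h2 := hd0 y (hy b (Finset.mem_insert_self _ _))
      simp [h1, h2]
    · intro y
      by_cases hy : y ∈ B b
      · have h1 := heq y (hbs y hy)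
        simpa [h1] using hp y
      · have h2 := hd0 y hy
        simpa [h2] using hq y
    · intro g hgT
      have hgc := hTc g hgT
      have i1 : Integrable (fun y => (inner ℝ (v' y - v y) (g y) : ℝ)) := by
        simp only [inner_sub_left]
        exact (h'.integrable_inner hgc).sub (h.integrable_inner hgc)
      have e1 : ∫ y, inner ℝ ((v' + d) y - v y) (g y) =
          (∫ y, inner ℝ (v' y - v y) (g y)) + ∫ y, inner ℝ (d y) (g y) := by
        rw [← integral_add i1 (hd.integrable_inner hgc)]
        refine integral_congr_ae (Filter.Eventually.of_forall fun y => ?_)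
        simp only [Pi.add_apply]
        rw [← inner_add_left]
        congr 1
        abel
      rw [e1, Finset.card_insert_of_notMem hb]
      refine (abs_add_le _ _).trans ?_
      have := hg g hgT
      have := horth g (Set.mem_insert_of_mem _ hgT)
      push_cast
      linarith
    · have e1 : ∫ y, inner ℝ (d y) (v' y) = ∫ y, inner ℝ (d y) (v y) := by
        refine integral_congr_ae (Filter.Eventually.of_forall fun y => ?_)
        by_cases hy : y ∈ B b
        · simp only [(heq y (hbs y hy)).1]
        · simp only [(hd0 y hy).1, inner_zero_left]
      have e2 := h'.integral_norm_add_sq hd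
      have e3 := (abs_le.1 (horth v (Set.mem_insert _ _))).1
      rw [e1] at e2
      rw [Finset.card_insert_of_notMem hb, Finset.sum_insert hb]
      simp only [Pi.add_apply v']
      rw [e2]
      push_cast
      linarith

/-- The Besicovitch covering theorem exhausts `Q` up to a null set by countably many disjoint balls
of admissible radius. By countable additivity a finite subfamily already carries more than half of
the integral. -/
theorem exists_disjoint_closedBalls {F : SpaceTime n → ℝ} (hF : IntegrableOn F Q)
    (hD : 0 < ∫ y in Q, F y) (good : SpaceTime n → Set ℝ)
    (hgood : ∀ y ∈ Q, ∀ δ > 0, (good y ∩ Set.Ioo 0 δ).Nonempty)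
    (hgoodQ : ∀ y ∈ Q, ∀ ρ ∈ good y, Metric.closedBall y ρ ⊆ Q) :
    ∃ (t : Set (SpaceTime n)) (r : SpaceTime n → ℝ) (s : Finset t),
      (∀ i : t, r i ∈ good i) ∧
      Pairwise (Function.onFun Disjoint fun i : t => Metric.closedBall i.1 (r i)) ∧
      (∫ y in Q, F y) / 2 < ∑ i ∈ s, ∫ y in Metric.closedBall i.1 (r i), F y := by
  obtain ⟨t, r, htc, htQ, htr, hcov, hdisj⟩ :=
    Besicovitch.exists_disjoint_closedBall_covering_ae (volume : Measure (SpaceTime n)) good Q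
      hgood (fun _ => 1) (fun _ _ => one_pos)
  let B : t → Set (SpaceTime n) := fun i => Metric.closedBall i.1 (r i.1)
  have hBQ : ∀ i, B i ⊆ Q := fun i => hgoodQ i.1 (htQ i.2) _ (htr i.1 i.2).1
  have hBdisj : Pairwise (Function.onFun Disjoint B) := fun i j hij =>
    hdisj i.2 j.2 fun h => hij (Subtype.ext h)
  have : Countable t := htc.to_subtype
  have hUQ : (⋃ i, B i) ⊆ Q := Set.iUnion_subset hBQ
  have hQU : (Q : Set (SpaceTime n)) =ᵐ[volume] ⋃ i, B i := by
    rw [Set.biUnion_eq_iUnion] at hcov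
    exact Filter.EventuallyLE.antisymm (ae_le_set.2 hcov) (Filter.Eventually.of_forall hUQ)
  have hBm : ∀ i, MeasurableSet (B i) := fun i => Metric.isClosed_closedBall.measurableSet
  have hsum : HasSum (fun i => ∫ y in B i, F y) (∫ y in ⋃ i, B i, F y) :=
    hasSum_integral_iUnion hBm hBdisj (hF.mono_set hUQ)
  rw [← setIntegral_congr_set hQU] at hsum
  obtain ⟨s, hs⟩ := (hsum.eventually (lt_mem_nhds (half_lt_self hD))).exists
  exact ⟨t, r, s, fun i => (htr i.1 i.2).1, hBdisj, hs⟩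

/-- One step of the iteration: a subsolution can be perturbed so that its energy increases by a
fixed fraction of its energy defect. -/
theorem IsSubsolution.exists_perturbation (hn : 2 ≤ n) (hc : 0 < c) (hQo : IsOpen Q)
    (hQb : Bornology.IsBounded Q)
    {v : SpaceTime n → EuclideanSpace ℝ (Fin n)} {u : SpaceTime n → Fin n → Fin n → ℝ}
    {q : SpaceTime n → ℝ} (h : IsSubsolution Q c v u q)
    {T : Set (SpaceTime n → EuclideanSpace ℝ (Fin n))} (hT : T.Finite)
    (hTc : ∀ g ∈ T, Continuous g) {ε : ℝ} (hε : 0 < ε) :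
    ∃ (v' : SpaceTime n → EuclideanSpace ℝ (Fin n)) (u' : SpaceTime n → Fin n → Fin n → ℝ)
      (q' : SpaceTime n → ℝ), IsSubsolution Q c v' u' q' ∧
      (∀ y, |q' y - q y| ≤ ε) ∧
      (∀ g ∈ T, |∫ y, inner ℝ (v' y - v y) (g y)| ≤ ε) ∧
      (∫ y, ‖v y‖ ^ 2) + gainConstant n c / 8 * ∫ y in Q, (n * c - ‖v y‖ ^ 2) ^ 2
        ≤ ∫ y, ‖v' y‖ ^ 2 := by
  have hn0 : n ≠ 0 := by omega
  have hβ := gainConstant_pos hn0 hc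
  set β := gainConstant n c
  set F : SpaceTime n → ℝ := fun y => (n * c - ‖v y‖ ^ 2) ^ 2 with hF
  have hFc : Continuous F := by
    have := h.continuous_velocity
    fun_prop
  have hFpos : ∀ y, 0 < F y := fun y =>
    pow_pos (by linarith [(h.strict y).norm_sq_lt hn0 (h.stress_trace y)]) 2
  have hFQ : IntegrableOn F Q :=
    (hFc.continuousOn.integrableOn_compact hQb.isCompact_closure).mono_set subset_closure
  rcases le_or_gt (∫ y in Q, F y) 0 with hD | hD
  · refine ⟨v, u, q, h, by simp [hε.le], by simp [hε.le], ?_⟩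
    have : β / 8 * ∫ y in Q, F y ≤ 0 := mul_nonpos_of_nonneg_of_nonpos (by positivity) hD
    linarith
  -- Radii on which `F` at most doubles its value at the centre, so that the gain there, stated
  -- through `F y`, dominates a multiple of the integral of `F`.
  let good : SpaceTime n → Set ℝ := fun y => {ρ | Metric.closedBall y ρ ⊆ Q ∧
    (∀ z ∈ Metric.closedBall y ρ, F z ≤ 2 * F y) ∧
    IsPerturbable c v u (Metric.closedBall y ρ)
      (β * F y * volume.real (Metric.closedBall y ρ))}
  have hgood : ∀ y ∈ Q, ∀ δ > 0, (good y ∩ Set.Ioo 0 δ).Nonempty := by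
    intro y hy δ hδ
    obtain ⟨δ₁, hδ₁, h₁⟩ := exists_isPerturbable_closedBall hn hc h.continuous_velocity
      h.continuous_stress y (h.stress_symm y) (h.stress_trace y) (h.strict y)
    obtain ⟨δ₂, hδ₂, h₂⟩ := Metric.isOpen_iff.1 hQo y hy
    obtain ⟨δ₃, hδ₃, h₃⟩ := Metric.eventually_nhds_iff.1 (hFc.continuousAt.eventually
      (gt_mem_nhds (show F y < 2 * F y by linarith [hFpos y])))
    have hmin : 0 < min (min δ₁ δ₂) (min δ₃ δ) :=
      lt_min (lt_min hδ₁ hδ₂) (lt_min hδ₃ hδ)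
    have hlt := half_lt_self hmin
    refine ⟨min (min δ₁ δ₂) (min δ₃ δ) / 2, ⟨?_, ?_, ?_⟩, half_pos hmin, ?_⟩
    · exact (Metric.closedBall_subset_ball (hlt.trans_le
        ((min_le_left _ _).trans (min_le_right _ _)))).trans h₂
    · exact fun z hz => (h₃ (lt_of_le_of_lt hz (hlt.trans_le
        ((min_le_right _ _).trans (min_le_left _ _))))).le
    · exact h₁ _ (half_pos hmin) (hlt.trans_le ((min_le_left _ _).trans (min_le_left _ _)))
    · exact hlt.trans_le ((min_le_right _ _).trans (min_le_right _ _))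
  obtain ⟨t, r, s, htr, hBdisj, hs⟩ := exists_disjoint_closedBalls hFQ hD good hgood
    fun y hy ρ hρ => hρ.1
  set B : t → Set (SpaceTime n) := fun i => Metric.closedBall i.1 (r i.1)
  have hBQ : ∀ i, B i ⊆ Q := fun i => (htr i).1
  have hG : ∑ i ∈ s, ∫ y in B i, F y ≤ ∑ i ∈ s, 2 * (F i.1 * volume.real (B i)) := by
    refine Finset.sum_le_sum fun i _ => ?_
    have h1 : ∫ y in B i, F y ≤ ∫ _ in B i, 2 * F i.1 :=
      setIntegral_mono_on (hFQ.mono_set (hBQ i))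
        (continuous_const.continuousOn.integrableOn_compact (isCompact_closedBall _ _))
        Metric.isClosed_closedBall.measurableSet (htr i).2.1
    rw [setIntegral_const, smul_eq_mul] at h1
    linarith
  set k : ℝ := (s.card : ℝ) with hk
  have hk0 : 0 ≤ k := by positivity
  set D := ∫ y in Q, F y with hDdef
  -- The tolerance is shared among the `k` balls. The gain is at least `β / 4 * D`, half of which
  -- may be lost to the cross terms; this leaves `β / 8 * D`.
  set ε' := min ε (β / 8 * D) / (2 * (k + 1)) with hε'
  have hmin : 0 < min ε (β / 8 * D) := lt_min hε (by positivity)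
  have hε'0 : 0 < ε' := by positivity
  have hkε : 2 * k * ε' ≤ min ε (β / 8 * D) := by
    rw [hε', mul_div_assoc', div_le_iff₀ (by positivity)]
    nlinarith
  have hε'ε : ε' ≤ ε := by
    rw [hε', div_le_iff₀ (by positivity)]
    have := min_le_left ε (β / 8 * D)
    nlinarith
  obtain ⟨v', u', q', hsub, -, hq, hg, hE⟩ := h.exists_perturbation_finset B
    (fun i => β * F i.1 * volume.real (B i)) hBQ hBdisj (fun i => (htr i).2.2) hT hTc
    hε'0 s
  refine ⟨v', u', q', hsub, fun y => (hq y).trans hε'ε, fun g hgT => (hg g hgT).trans ?_, ?_⟩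
  · have := hkε.trans (min_le_left _ _)
    have : 0 ≤ k * ε' := by positivity
    linarith
  · have h1 := hkε.trans (min_le_right _ _)
    have h2 : ∑ i ∈ s, β * F i.1 * volume.real (B i) =
        β / 2 * ∑ i ∈ s, 2 * (F i.1 * volume.real (B i)) := by
      rw [Finset.mul_sum]
      exact Finset.sum_congr rfl fun i _ => by ring
    have h3 : β / 2 * (D / 2) ≤ β / 2 * ∑ i ∈ s, 2 * (F i.1 * volume.real (B i)) :=
      mul_le_mul_of_nonneg_left (hs.le.trans hG) (by positivity)
    rw [h2] at hE
    have h4 : β / 2 * (D / 2) = β / 4 * D := by ring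
    linarith

end Step

open Filter in
-- Summing the orthogonality bounds shows that `V m - V k` is almost orthogonal to `V k`. By
-- Pythagoras its squared norm is then the increase of `‖V‖²` up to a geometric error, and these
-- increases tend to zero because a bounded monotone sequence converges.
theorem cauchySeq_of_almost_orthogonal {H : Type*} [NormedAddCommGroup H] [InnerProductSpace ℝ H]
    {V : ℕ → H} (hmono : Monotone fun k => ‖V k‖ ^ 2) {M : ℝ} (hM : ∀ k, ‖V k‖ ^ 2 ≤ M)
    (horth : ∀ i k, i ≤ k → |(inner ℝ (V (k + 1) - V k) (V i) : ℝ)| ≤ (1 / 2) ^ k) :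
    CauchySeq V := by
  have hbdd : BddAbove (Set.range fun k => ‖V k‖ ^ 2) := ⟨M, by rintro _ ⟨k, rfl⟩; exact hM k⟩
  have hlim := tendsto_atTop_ciSup hmono hbdd
  set L := ⨆ k, ‖V k‖ ^ 2
  have hle : ∀ k, ‖V k‖ ^ 2 ≤ L := fun k => le_ciSup hbdd k
  have hsum : ∀ k m, k ≤ m →
      |(inner ℝ (V m - V k) (V k) : ℝ)| ≤ 2 * (1 / 2) ^ k - 2 * (1 / 2) ^ m := by
    intro k m hkm
    induction m, hkm using Nat.le_induction with
    | base => simp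
    | succ m hkm ih =>
      have h1 : V (m + 1) - V k = (V (m + 1) - V m) + (V m - V k) := by abel
      rw [h1, inner_add_left]
      refine (abs_add_le _ _).trans ((add_le_add (horth k m hkm) ih).trans (le_of_eq ?_))
      rw [pow_succ]
      ring
  have hb : Tendsto (fun k : ℕ => √(L - ‖V k‖ ^ 2 + 4 * (1 / 2) ^ k)) atTop (nhds 0) := by
    have h1 := (hlim.const_sub L).add
      ((tendsto_pow_atTop_nhds_zero_of_lt_one (r := (1 / 2 : ℝ)) (by norm_num)
        (by norm_num)).const_mul 4)
    simpa using h1.sqrt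
  refine cauchySeq_of_le_tendsto_0' _ (fun k m hkm => ?_) hb
  rw [dist_comm, dist_eq_norm]
  refine Real.le_sqrt_of_sq_le ?_
  have h1 : ‖V m‖ ^ 2 = ‖V k‖ ^ 2 + 2 * inner ℝ (V m - V k) (V k) + ‖V m - V k‖ ^ 2 := by
    have := norm_add_sq_real (V k) (V m - V k)
    rwa [add_sub_cancel, real_inner_comm] at this
  have h2 := (abs_le.1 (hsum k m hkm)).1
  have h3 : (0 : ℝ) < (1 / 2) ^ m := by positivity
  linarith [hle m]

/-! ### The sequence of subsolutions -/

section Iteration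

variable {n : ℕ} {Q : Set (SpaceTime n)} {c : ℝ}

/-- A subsolution together with the fields to which later perturbations are almost orthogonal. -/
structure SubsolutionState (Q : Set (SpaceTime n)) (c : ℝ) where
  /-- The velocity. -/
  v : SpaceTime n → EuclideanSpace ℝ (Fin n)
  /-- The trace free stress. -/
  u : SpaceTime n → Fin n → Fin n → ℝ
  /-- The pressure. -/
  q : SpaceTime n → ℝ
  /-- The test fields. -/
  T : Set (SpaceTime n → EuclideanSpace ℝ (Fin n))
  isSubsolution : IsSubsolution Q c v u q
  finite : T.Finite
  continuous : ∀ g ∈ T, Continuous g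
  mem : v ∈ T

theorem exists_subsolution_seq (hn : 2 ≤ n) (hc : 0 < c) (hQo : IsOpen Q)
    (hQb : Bornology.IsBounded Q) :
    ∃ (v : ℕ → SpaceTime n → EuclideanSpace ℝ (Fin n)) (u : ℕ → SpaceTime n → Fin n → Fin n → ℝ)
      (q : ℕ → SpaceTime n → ℝ), (∀ k, IsSubsolution Q c (v k) (u k) (q k)) ∧ q 0 = 0 ∧
      (∀ k y, |q (k + 1) y - q k y| ≤ (1 / 2) ^ k) ∧
      (∀ i k, i ≤ k → |∫ y, inner ℝ (v (k + 1) y - v k y) (v i y)| ≤ (1 / 2) ^ k) ∧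
      ∀ k, (∫ y, ‖v k y‖ ^ 2) + gainConstant n c / 8 * ∫ y in Q, (n * c - ‖v k y‖ ^ 2) ^ 2
        ≤ ∫ y, ‖v (k + 1) y‖ ^ 2 := by
  have step : ∀ (k : ℕ) (s : SubsolutionState Q c), ∃ s' : SubsolutionState Q c, s.T ⊆ s'.T ∧
      (∀ y, |s'.q y - s.q y| ≤ (1 / 2) ^ k) ∧
      (∀ g ∈ s.T, |∫ y, inner ℝ (s'.v y - s.v y) (g y)| ≤ (1 / 2) ^ k) ∧
      (∫ y, ‖s.v y‖ ^ 2) + gainConstant n c / 8 * ∫ y in Q, (n * c - ‖s.v y‖ ^ 2) ^ 2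
        ≤ ∫ y, ‖s'.v y‖ ^ 2 := by
    intro k s
    obtain ⟨v', u', q', h', hq, hg, hE⟩ := s.isSubsolution.exists_perturbation hn hc hQo hQb
      s.finite s.continuous (ε := (1 / 2) ^ k) (by positivity)
    exact ⟨⟨v', u', q', insert v' s.T, h', s.finite.insert v', by
      rintro g (rfl | hg)
      exacts [h'.continuous_velocity, s.continuous g hg], Set.mem_insert _ _⟩,
      Set.subset_insert _ _, hq, hg, hE⟩
  choose next hT hq hg hE using step
  let s₀ : SubsolutionState Q c := ⟨0, 0, 0, {0}, isSubsolution_zero Q hc, Set.finite_singleton _,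
    by rintro g rfl; exact continuous_zero, rfl⟩
  let S : ℕ → SubsolutionState Q c := fun k => Nat.rec s₀ next k
  -- Test fields are never discarded, so each increment is almost orthogonal to every earlier
  -- velocity.
  have hTmono : Monotone fun k => (S k).T := monotone_nat_of_le_succ fun k => hT k (S k)
  exact ⟨fun k => (S k).v, fun k => (S k).u, fun k => (S k).q, fun k => (S k).isSubsolution, rfl,
    fun k => hq k (S k), fun i k hik => hg k (S k) _ (hTmono hik (S i).mem), fun k => hE k (S k)⟩

end Iteration

/-! ### Uniform bounds for dominated convergence -/

section Bounds

variable {n : ℕ}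

/-- The integrable function that dominates `momentumPairing`. -/
noncomputable def momentumBound (φ : SpaceTime n → EuclideanSpace ℝ (Fin n)) (y : SpaceTime n) :
    ℝ :=
  (∑ i, |timeDeriv φ y i|) + (∑ i, ∑ j, |spaceDeriv j φ y i|) + |∑ i, spaceDeriv i φ y i|

theorem abs_momentumPairing_le (φ : SpaceTime n → EuclideanSpace ℝ (Fin n)) (y : SpaceTime n)
    {v : EuclideanSpace ℝ (Fin n)} {u : Fin n → Fin n → ℝ} {q K : ℝ} (hv : ∀ i, |v i| ≤ K)
    (hu : ∀ i j, |u i j| ≤ K) (hq : |q| ≤ K) :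
    |momentumPairing φ y v u q| ≤ K * momentumBound φ y := by
  rw [momentumPairing, momentumBound, mul_add, mul_add]
  refine (abs_add_three _ _ _).trans (add_le_add_three ?_ ?_ ?_)
  · rw [Finset.mul_sum]
    refine (Finset.abs_sum_le_sum_abs _ _).trans (Finset.sum_le_sum fun i _ => ?_)
    rw [abs_mul]
    exact mul_le_mul_of_nonneg_right (hv i) (abs_nonneg _)
  · rw [Finset.mul_sum]
    refine (Finset.abs_sum_le_sum_abs _ _).trans (Finset.sum_le_sum fun i _ => ?_)
    rw [Finset.mul_sum]
    refine (Finset.abs_sum_le_sum_abs _ _).trans (Finset.sum_le_sum fun j _ => ?_)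
    rw [abs_mul]
    exact mul_le_mul_of_nonneg_right (hu i j) (abs_nonneg _)
  · rw [abs_mul]
    exact mul_le_mul_of_nonneg_right hq (abs_nonneg _)

theorem integrable_momentumBound {φ : SpaceTime n → EuclideanSpace ℝ (Fin n)}
    (hφ : ContDiff ℝ ∞ φ) (hφc : HasCompactSupport φ) : Integrable (momentumBound φ) := by
  refine Continuous.integrable_of_hasCompactSupport ?_
    (HasCompactSupport.intro hφc fun y hy => ?_)
  · have h1 := continuous_timeDeriv hφ
    have h2 := continuous_spaceDeriv hφ
    unfold momentumBound
    fun_prop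
  · simp [momentumBound, timeDeriv, spaceDeriv, fderiv_eq_zero_of_notMem_tsupport hy]

theorem abs_divergencePairing_le (ψ : SpaceTime n → ℝ) (y : SpaceTime n)
    {v : EuclideanSpace ℝ (Fin n)} {K : ℝ} (hv : ∀ i, |v i| ≤ K) :
    |divergencePairing ψ y v| ≤ K * ∑ i, |spaceDeriv i ψ y| := by
  rw [divergencePairing, Finset.mul_sum]
  refine (Finset.abs_sum_le_sum_abs _ _).trans (Finset.sum_le_sum fun i _ => ?_)
  rw [abs_mul]
  exact mul_le_mul_of_nonneg_right (hv i) (abs_nonneg _)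

theorem integrable_sum_abs_spaceDeriv {ψ : SpaceTime n → ℝ}
    (hψ : ContDiff ℝ ∞ ψ) (hψc : HasCompactSupport ψ) :
    Integrable fun y => ∑ i, |spaceDeriv i ψ y| := by
  refine Continuous.integrable_of_hasCompactSupport ?_
    (HasCompactSupport.intro hψc fun y hy => ?_)
  · have h2 := continuous_spaceDeriv hψ
    fun_prop
  · simp [spaceDeriv, fderiv_eq_zero_of_notMem_tsupport hy]

theorem IsStrictState.abs_stress_le {c : ℝ} (hc : 0 ≤ c) {v : EuclideanSpace ℝ (Fin n)}
    {u : Fin n → Fin n → ℝ} (h : IsStrictState c v u) (hs : ∀ i j, u i j = u j i)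
    (hu : ∑ i, u i i = 0) (i j : Fin n) : |u i j| ≤ n * c + c := by
  have h1 := h.abs_defectMatrix_le hs hu i j
  have h2 : u i j = defectMatrix c v u i j - (if i = j then c else 0) + v i * v j := by
    simp only [defectMatrix, Matrix.of_apply]; ring
  have h3 : |v i * v j| ≤ ‖v‖ ^ 2 := by
    rw [abs_mul, sq]
    exact mul_le_mul (PiLp.norm_apply_le v i) (PiLp.norm_apply_le v j) (abs_nonneg _)
      (norm_nonneg _)
  have h4 : |if i = j then c else 0| ≤ c := by
    split_ifs <;> simp [abs_of_nonneg, hc]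
  rw [h2]
  refine (abs_add_le _ _).trans ?_
  have := abs_sub (defectMatrix c v u i j) (if i = j then c else 0)
  linarith

end Bounds

/-! ### Passage to the limit -/

section Limit

variable {n : ℕ} {Q : Set (SpaceTime n)} {c : ℝ}

open Filter in
theorem exists_ae_tendsto_of_almost_orthogonal
    {v : ℕ → SpaceTime n → EuclideanSpace ℝ (Fin n)} (hv : ∀ k, MemLp (v k) 2 volume)
    (hmono : Monotone fun k => ∫ y, ‖v k y‖ ^ 2) {M : ℝ} (hM : ∀ k, ∫ y, ‖v k y‖ ^ 2 ≤ M)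
    (horth : ∀ i k, i ≤ k → |∫ y, inner ℝ (v (k + 1) y - v k y) (v i y)| ≤ (1 / 2) ^ k) :
    ∃ (w : SpaceTime n → EuclideanSpace ℝ (Fin n)) (ns : ℕ → ℕ), AEStronglyMeasurable w volume ∧
      StrictMono ns ∧ ∀ᵐ y, Tendsto (fun k => v (ns k) y) atTop (nhds (w y)) := by
  let V : ℕ → Lp (EuclideanSpace ℝ (Fin n)) 2 (volume : Measure (SpaceTime n)) :=
    fun k => (hv k).toLp (v k)
  have hcoe : ∀ k, V k =ᵐ[volume] v k := fun k => (hv k).coeFn_toLp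
  have hnorm : ∀ k, ‖V k‖ ^ 2 = ∫ y, ‖v k y‖ ^ 2 := by
    intro k
    rw [← real_inner_self_eq_norm_sq, L2.inner_def]
    refine integral_congr_ae ?_
    filter_upwards [hcoe k] with y hy
    rw [hy, real_inner_self_eq_norm_sq]
  have hinner : ∀ i k, (inner ℝ (V (k + 1) - V k) (V i) : ℝ) =
      ∫ y, inner ℝ (v (k + 1) y - v k y) (v i y) := by
    intro i k
    rw [L2.inner_def]
    refine integral_congr_ae ?_
    filter_upwards [hcoe k, hcoe (k + 1), hcoe i, Lp.coeFn_sub (V (k + 1)) (V k)] with y h1 h2 h3 h4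
    rw [h4, Pi.sub_apply, h1, h2, h3]
  have hC : CauchySeq V := cauchySeq_of_almost_orthogonal (M := M)
    (by simpa only [hnorm] using hmono) (by simpa only [hnorm] using hM) (by simpa only [hinner] using horth)
  obtain ⟨W, hW⟩ := cauchySeq_tendsto_of_complete hC
  obtain ⟨ns, hns, hae⟩ := (tendstoInMeasure_of_tendsto_Lp hW).exists_seq_tendsto_ae
  refine ⟨W, ns, Lp.aestronglyMeasurable W, hns, ?_⟩
  filter_upwards [hae, ae_all_iff.2 hcoe] with y h1 h2
  exact h1.congr fun k => h2 (ns k)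

theorem IsSubsolution.norm_velocity_sq_le {v : SpaceTime n → EuclideanSpace ℝ (Fin n)}
    {u : SpaceTime n → Fin n → Fin n → ℝ} {q : SpaceTime n → ℝ} (h : IsSubsolution Q c v u q)
    (y : SpaceTime n) : ‖v y‖ ^ 2 ≤ n * c :=
  (h.strict y).norm_sq_le (h.stress_trace y)

theorem IsSubsolution.integral_norm_sq_le (hQo : IsOpen Q) (hQb : Bornology.IsBounded Q)
    {v : SpaceTime n → EuclideanSpace ℝ (Fin n)}
    {u : SpaceTime n → Fin n → Fin n → ℝ} {q : SpaceTime n → ℝ} (h : IsSubsolution Q c v u q) :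
    ∫ y, ‖v y‖ ^ 2 ≤ n * c * volume.real Q := by
  rw [← setIntegral_eq_integral_of_forall_compl_eq_zero (s := Q)
    (fun y hy => by simp [(h.eq_zero y hy).1])]
  refine (setIntegral_mono_on h.integrable_norm_sq.integrableOn
    (integrableOn_const (C := n * c) hQb.measure_lt_top.ne) hQo.measurableSet
    fun y _ => h.norm_velocity_sq_le y).trans ?_
  rw [setIntegral_const, smul_eq_mul, mul_comm]

open Filter in
/-- If the energy defect tends to zero in `L²` along an almost everywhere convergent sequence of
subsolutions, then the limit saturates the energy bound. -/
theorem ae_norm_sq_eq_of_tendsto (hQo : IsOpen Q) (hQb : Bornology.IsBounded Q)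
    {v : ℕ → SpaceTime n → EuclideanSpace ℝ (Fin n)} {u : ℕ → SpaceTime n → Fin n → Fin n → ℝ}
    {q : ℕ → SpaceTime n → ℝ} (h : ∀ k, IsSubsolution Q c (v k) (u k) (q k))
    (hD : Tendsto (fun k => ∫ y in Q, (n * c - ‖v k y‖ ^ 2) ^ 2) atTop (nhds 0))
    {w : SpaceTime n → EuclideanSpace ℝ (Fin n)} (hw : AEStronglyMeasurable w volume)
    (hlim : ∀ᵐ y, Tendsto (fun k => v k y) atTop (nhds (w y))) :
    ∀ᵐ y, y ∈ Q → ‖w y‖ ^ 2 = n * c := by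
  have hlim' : ∀ᵐ y ∂volume.restrict Q, Tendsto (fun k => (n * c - ‖v k y‖ ^ 2) ^ 2) atTop
      (nhds ((n * c - ‖w y‖ ^ 2) ^ 2)) := by
    filter_upwards [ae_restrict_of_ae hlim] with y hy
    exact ((hy.norm.pow 2).const_sub _).pow 2
  have hbound : ∀ k y, ‖(n * c - ‖v k y‖ ^ 2) ^ 2‖ ≤ (n * c) ^ 2 := by
    intro k y
    have h1 := (h k).norm_velocity_sq_le y
    have h2 := sq_nonneg ‖v k y‖
    rw [Real.norm_of_nonneg (sq_nonneg _)]
    exact pow_le_pow_left₀ (by linarith) (by linarith) 2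
  have hconst : IntegrableOn (fun _ : SpaceTime n => (n * c) ^ 2) Q :=
    integrableOn_const hQb.measure_lt_top.ne
  have hmeas : AEStronglyMeasurable (fun y => (n * c - ‖w y‖ ^ 2) ^ 2) (volume.restrict Q) :=
    ((aestronglyMeasurable_const.sub (hw.norm.pow 2)).pow 2).restrict
  have hint : IntegrableOn (fun y => (n * c - ‖w y‖ ^ 2) ^ 2) Q := by
    refine hconst.mono' hmeas ?_
    filter_upwards [hlim'] with y hy
    exact le_of_tendsto hy.norm (Eventually.of_forall fun k => hbound k y)
  have hDCT := tendsto_integral_of_dominated_convergence (fun _ => (n * c) ^ 2)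
    (fun k => by
      have := (h k).continuous_velocity
      exact (show Continuous fun y => (n * c - ‖v k y‖ ^ 2) ^ 2 by fun_prop).aestronglyMeasurable)
    hconst (fun k => Eventually.of_forall (hbound k)) hlim'
  have h0 := tendsto_nhds_unique hDCT hD
  have hae := (setIntegral_eq_zero_iff_of_nonneg_ae
    (Eventually.of_forall fun y => sq_nonneg _) hint).1 h0
  filter_upwards [(ae_restrict_iff' hQo.measurableSet).1 hae] with y hy hyQ
  have := pow_eq_zero_iff (two_ne_zero) |>.1 (hy hyQ)
  linarith

open Filter in
-- The stress needs no convergence argument of its own: the entries of the defect matrix are bounded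
-- by its trace, which tends to `n c - ‖w‖² = 0`.
theorem tendsto_stress {v : ℕ → SpaceTime n → EuclideanSpace ℝ (Fin n)}
    {u : ℕ → SpaceTime n → Fin n → Fin n → ℝ}
    {q : ℕ → SpaceTime n → ℝ} (h : ∀ k, IsSubsolution Q c (v k) (u k) (q k)) {y : SpaceTime n}
    {w : EuclideanSpace ℝ (Fin n)} (hw : ‖w‖ ^ 2 = n * c)
    (hlim : Tendsto (fun k => v k y) atTop (nhds w)) :
    Tendsto (fun k => u k y) atTop (nhds fun i j => w i * w j - if i = j then c else 0) := by
  rw [tendsto_pi_nhds]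
  intro i
  rw [tendsto_pi_nhds]
  intro j
  have hR : Tendsto (fun k => defectMatrix c (v k y) (u k y) i j) atTop (nhds 0) := by
    refine squeeze_zero_norm (fun k => (h k).strict y |>.abs_defectMatrix_le
      ((h k).stress_symm y) ((h k).stress_trace y) i j) ?_
    have := (hlim.norm.pow 2).const_sub (n * c : ℝ)
    rwa [hw, sub_self] at this
  have hco : ∀ i, Tendsto (fun k => v k y i) atTop (nhds (w i)) := fun i =>
    ((by fun_prop : Continuous fun z : EuclideanSpace ℝ (Fin n) => z i).tendsto w).comp hlim
  have h1 := (hR.sub_const (if i = j then c else 0)).add ((hco i).mul (hco j))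
  rw [zero_sub, neg_add_eq_sub] at h1
  refine h1.congr fun k => ?_
  simp only [defectMatrix, Matrix.of_apply]
  ring

open Filter in
theorem tendsto_momentumPairing (φ : SpaceTime n → EuclideanSpace ℝ (Fin n)) (y : SpaceTime n)
    {v : ℕ → EuclideanSpace ℝ (Fin n)} {u : ℕ → Fin n → Fin n → ℝ} {q : ℕ → ℝ}
    {w : EuclideanSpace ℝ (Fin n)} {U : Fin n → Fin n → ℝ} {p : ℝ}
    (hv : Tendsto v atTop (nhds w)) (hu : Tendsto u atTop (nhds U))
    (hq : Tendsto q atTop (nhds p)) :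
    Tendsto (fun k => momentumPairing φ y (v k) (u k) (q k)) atTop
      (nhds (momentumPairing φ y w U p)) := by
  have hv' : ∀ i, Tendsto (fun k => v k i) atTop (nhds (w i)) := fun i =>
    ((by fun_prop : Continuous fun z : EuclideanSpace ℝ (Fin n) => z i).tendsto w).comp hv
  have hu' : ∀ i j, Tendsto (fun k => u k i j) atTop (nhds (U i j)) := fun i j =>
    tendsto_pi_nhds.1 (tendsto_pi_nhds.1 hu i) j
  exact ((tendsto_finsetSum _ fun i _ => (hv' i).mul_const _).add
    (tendsto_finsetSum _ fun i _ => tendsto_finsetSum _ fun j _ => (hu' i j).mul_const _)).add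
    (hq.mul_const _)

open Filter in
/-- Almost everywhere limits of bounded solutions of the linear system are solutions. -/
theorem integral_pairing_eq_zero_of_tendsto
    {v : ℕ → SpaceTime n → EuclideanSpace ℝ (Fin n)} {u : ℕ → SpaceTime n → Fin n → Fin n → ℝ}
    {q : ℕ → SpaceTime n → ℝ} (h : ∀ k, IsLinearEulerSolution (v k) (u k) (q k)) {K : ℝ}
    (hvK : ∀ k y i, |v k y i| ≤ K) (huK : ∀ k y i j, |u k y i j| ≤ K) (hqK : ∀ k y, |q k y| ≤ K)
    {w : SpaceTime n → EuclideanSpace ℝ (Fin n)} {U : SpaceTime n → Fin n → Fin n → ℝ}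
    {p : SpaceTime n → ℝ}
    (hv : ∀ᵐ y, Tendsto (fun k => v k y) atTop (nhds (w y)))
    (hu : ∀ᵐ y, Tendsto (fun k => u k y) atTop (nhds (U y)))
    (hq : ∀ᵐ y, Tendsto (fun k => q k y) atTop (nhds (p y))) :
    (∀ φ : SpaceTime n → EuclideanSpace ℝ (Fin n), ContDiff ℝ ∞ φ → HasCompactSupport φ →
      ∫ y, momentumPairing φ y (w y) (U y) (p y) = 0) ∧
    (∀ ψ : SpaceTime n → ℝ, ContDiff ℝ ∞ ψ → HasCompactSupport ψ →
      ∫ y, divergencePairing ψ y (w y) = 0) := by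
  constructor
  · intro φ hφ hφc
    have hlim : ∀ᵐ y, Tendsto (fun k => momentumPairing φ y (v k y) (u k y) (q k y)) atTop
        (nhds (momentumPairing φ y (w y) (U y) (p y))) := by
      filter_upwards [hv, hu, hq] with y h1 h2 h3
      exact tendsto_momentumPairing φ y h1 h2 h3
    have := tendsto_integral_of_dominated_convergence (fun y => K * momentumBound φ y)
      (fun k => (integrable_momentumPairing hφ hφc (h k).continuous_velocity
        (h k).continuous_stress (h k).continuous_pressure).aestronglyMeasurable)
      ((integrable_momentumBound hφ hφc).const_mul K)
      (fun k => Eventually.of_forall fun y =>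
        abs_momentumPairing_le φ y (hvK k y) (huK k y) (hqK k y)) hlim
    simp only [fun k => (h k).momentum φ hφ hφc] at this
    exact tendsto_nhds_unique this tendsto_const_nhds
  · intro ψ hψ hψc
    have hlim : ∀ᵐ y, Tendsto (fun k => divergencePairing ψ y (v k y)) atTop
        (nhds (divergencePairing ψ y (w y))) := by
      filter_upwards [hv] with y h1
      have hc : Continuous fun s : EuclideanSpace ℝ (Fin n) => divergencePairing ψ y s := by
        unfold divergencePairing
        fun_prop
      exact (hc.tendsto (w y)).comp h1
    have := tendsto_integral_of_dominated_convergence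
      (fun y => K * ∑ i, |spaceDeriv i ψ y|)
      (fun k => (integrable_divergencePairing hψ hψc
        (h k).continuous_velocity).aestronglyMeasurable)
      ((integrable_sum_abs_spaceDeriv hψ hψc).const_mul K)
      (fun k => Eventually.of_forall fun y => abs_divergencePairing_le ψ y (hvK k y)) hlim
    simp only [fun k => (h k).incompressible ψ hψ hψc] at this
    exact tendsto_nhds_unique this tendsto_const_nhds

open Filter in
theorem exists_saturated_limit (hn : 2 ≤ n) (hc : 0 < c) (hQo : IsOpen Q)
    (hQb : Bornology.IsBounded Q) :
    ∃ (v : SpaceTime n → EuclideanSpace ℝ (Fin n)) (q : SpaceTime n → ℝ),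
      AEStronglyMeasurable v volume ∧ Measurable q ∧ (∀ y, |q y| ≤ 2) ∧
      (∀ y ∉ Q, v y = 0 ∧ q y = 0) ∧ (∀ᵐ y, y ∈ Q → ‖v y‖ ^ 2 = n * c) ∧
      (∀ φ : SpaceTime n → EuclideanSpace ℝ (Fin n), ContDiff ℝ ∞ φ → HasCompactSupport φ →
        ∫ y, momentumPairing φ y (v y)
          (fun i j => v y i * v y j - if i = j then Q.indicator (fun _ => c) y else 0) (q y) = 0) ∧
      (∀ ψ : SpaceTime n → ℝ, ContDiff ℝ ∞ ψ → HasCompactSupport ψ →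
        ∫ y, divergencePairing ψ y (v y) = 0) := by
  obtain ⟨v, u, q, h, hq0, hq, horth, hE⟩ := exists_subsolution_seq hn hc hQo hQb
  have hγ : 0 < gainConstant n c / 8 := by
    have := gainConstant_pos (show n ≠ 0 by omega) hc
    positivity
  have hDpos : ∀ k, 0 ≤ ∫ y in Q, (n * c - ‖v k y‖ ^ 2) ^ 2 := fun k =>
    integral_nonneg fun y => sq_nonneg _
  have hmono : Monotone fun k => ∫ y, ‖v k y‖ ^ 2 := monotone_nat_of_le_succ fun k =>
    (le_add_of_nonneg_right (mul_nonneg hγ.le (hDpos k))).trans (hE k)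
  have hM : ∀ k, ∫ y, ‖v k y‖ ^ 2 ≤ n * c * volume.real Q := fun k =>
    (h k).integral_norm_sq_le hQo hQb
  have hElim := tendsto_atTop_ciSup hmono ⟨_, by rintro _ ⟨k, rfl⟩; exact hM k⟩
  -- The defect is at most a multiple of the energy increment, and the increments of a convergent
  -- sequence vanish.
  have hD : Tendsto (fun k => ∫ y in Q, (n * c - ‖v k y‖ ^ 2) ^ 2) atTop (nhds 0) := by
    have h1 := ((hElim.comp (tendsto_add_atTop_nat 1)).sub hElim).const_mul
      (gainConstant n c / 8)⁻¹
    rw [sub_self, mul_zero] at h1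
    refine squeeze_zero hDpos (fun k => ?_) h1
    rw [le_inv_mul_iff₀ hγ]
    have := hE k
    simp only [Function.comp_apply]
    linarith
  obtain ⟨w, ns, hw, hns, hwlim⟩ := exists_ae_tendsto_of_almost_orthogonal
    (fun k => (h k).continuous_velocity.memLp_of_hasCompactSupport (h k).compact_velocity)
    hmono hM horth
  have hqC : ∀ y, ∃ a, Tendsto (fun k => q k y) atTop (nhds a) := fun y =>
    cauchySeq_tendsto_of_complete (cauchySeq_of_le_geometric (1 / 2) 1 (by norm_num) fun k => by
      rw [one_mul, dist_comm]
      exact hq k y)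
  choose p hp using hqC
  have hqb : ∀ k y, |q k y| ≤ 2 - 2 * (1 / 2) ^ k := by
    intro k y
    induction k with
    | zero => simp [hq0]
    | succ k ih =>
      have h1 : q (k + 1) y = (q (k + 1) y - q k y) + q k y := by ring
      rw [h1]
      refine (abs_add_le _ _).trans ((add_le_add (hq k y) ih).trans (le_of_eq ?_))
      rw [pow_succ]
      ring
  have hqb2 : ∀ k y, |q k y| ≤ 2 := fun k y =>
    (hqb k y).trans (by have : (0 : ℝ) < (1 / 2) ^ k := by positivity
                        linarith)
  have hv0 : ∀ y ∉ Q, ∀ k, v k y = 0 := fun y hy k => ((h k).eq_zero y hy).1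
  have hsub : ∀ k, IsSubsolution Q c (v (ns k)) (u (ns k)) (q (ns k)) := fun k => h (ns k)
  -- The `L²` limit `w` is determined only almost everywhere; truncation to `Q` makes it vanish at
  -- every point outside.
  have hvlim : ∀ᵐ y, Tendsto (fun k => v (ns k) y) atTop (nhds (Q.indicator w y)) := by
    filter_upwards [hwlim] with y hy
    by_cases hyQ : y ∈ Q
    · rwa [Set.indicator_of_mem hyQ]
    · rw [Set.indicator_of_notMem hyQ]
      simp only [hv0 y hyQ]
      exact tendsto_const_nhds
  have hvm : AEStronglyMeasurable (Q.indicator w) volume := hw.indicator hQo.measurableSet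
  have hsat := ae_norm_sq_eq_of_tendsto hQo hQb hsub (hD.comp hns.tendsto_atTop) hvm hvlim
  have hulim : ∀ᵐ y, Tendsto (fun k => u (ns k) y) atTop (nhds fun i j =>
      Q.indicator w y i * Q.indicator w y j - if i = j then Q.indicator (fun _ => c) y else 0) := by
    filter_upwards [hvlim, hsat] with y h1 h2
    by_cases hyQ : y ∈ Q
    · rw [Set.indicator_of_mem hyQ (fun _ => c)]
      exact tendsto_stress hsub (h2 hyQ) h1
    · simp only [Set.indicator_of_notMem hyQ, fun k => ((hsub k).eq_zero y hyQ).2.1,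
        PiLp.zero_apply, mul_zero, ite_self, sub_zero]
      exact tendsto_const_nhds
  set K := √(n * c) + (n * c + c) + 2
  have hnc : 0 ≤ n * c := by positivity
  have hsqrt := Real.sqrt_nonneg (n * c)
  have hpair := integral_pairing_eq_zero_of_tendsto (K := K)
    (fun k => (hsub k).toIsLinearEulerSolution)
    (fun k y i => (PiLp.norm_apply_le _ i).trans
      ((Real.le_sqrt_of_sq_le ((hsub k).norm_velocity_sq_le y)).trans (by simp only [K]; linarith)))
    (fun k y i j => (((hsub k).strict y).abs_stress_le hc.le ((hsub k).stress_symm y)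
      ((hsub k).stress_trace y) i j).trans (by simp only [K]; linarith))
    (fun k y => (hqb2 (ns k) y).trans (by simp only [K]; linarith))
    hvlim hulim (Eventually.of_forall fun y => (hp y).comp hns.tendsto_atTop)
  refine ⟨Q.indicator w, p, hvm, ?_, fun y => ?_, fun y hy => ⟨?_, ?_⟩, hsat, hpair.1, hpair.2⟩
  · exact measurable_of_tendsto_metrizable (fun k => (h k).continuous_pressure.measurable)
      (tendsto_pi_nhds.2 hp)
  · exact le_of_tendsto (hp y).abs (Eventually.of_forall fun k => hqb2 k y)
  · exact Set.indicator_of_notMem hy w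
  · refine tendsto_nhds_unique (hp y) ?_
    simp only [fun k => ((h k).eq_zero y hy).2.2]
    exact tendsto_const_nhds

end Limit

/-! ### From the saturated limit to the Euler equations -/

theorem momentumPairing_sub_scalar {n : ℕ} (φ : SpaceTime n → EuclideanSpace ℝ (Fin n))
    (y : SpaceTime n) (v : EuclideanSpace ℝ (Fin n)) (u : Fin n → Fin n → ℝ) (a q : ℝ) :
    momentumPairing φ y v (fun i j => u i j - if i = j then a else 0) q =
      momentumPairing φ y v u (q - a) := by
  simp only [momentumPairing, sub_mul, Finset.sum_sub_distrib, ite_mul, zero_mul,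
    Finset.sum_ite_eq, Finset.mem_univ, if_true, ← Finset.mul_sum]
  ring

theorem theorem2 (n : ℕ) (hn : 2 ≤ n) :
    ∃ (v : SpaceTime n → EuclideanSpace ℝ (Fin n)) (p : SpaceTime n → ℝ),
      MemLp v ⊤ volume ∧ MemLp p ⊤ volume ∧
      IsDistributionalEulerSolution (fun _ => 0) v p ∧
      ¬ (v =ᵐ[volume] 0) ∧
      HasCompactSupport v ∧ HasCompactSupport p ∧
      (∀ᵐ t : ℝ, t ∈ Set.Ioo (-1 : ℝ) 1 →
        ∫ x : EuclideanSpace ℝ (Fin n), ‖v (x, t)‖ ^ 2 = 1) ∧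
      (∀ (x : EuclideanSpace ℝ (Fin n)) (t : ℝ), 1 < |t| → v (x, t) = 0) := by
  have hnpos : (0 : ℝ) < n := by exact_mod_cast (by omega : 0 < n)
  set Ω := Metric.ball (0 : EuclideanSpace ℝ (Fin n)) 1 with hΩ
  have hΩpos : 0 < volume.real Ω :=
    ENNReal.toReal_pos (Metric.measure_ball_pos _ _ one_pos).ne' measure_ball_lt_top.ne
  set Q : Set (SpaceTime n) := Ω ×ˢ Set.Ioo (-1 : ℝ) 1 with hQ
  have hQo : IsOpen Q := Metric.isOpen_ball.prod isOpen_Ioo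
  have hQb : Bornology.IsBounded Q := Metric.isBounded_ball.prod (Metric.isBounded_Ioo _ _)
  -- Each time slice of the cylinder then carries energy `n c |Ω| = 1`.
  set c : ℝ := 1 / (n * volume.real Ω) with hc
  have hc0 : 0 < c := by positivity
  have hnc : n * c * volume.real Ω = 1 := by rw [hc]; field_simp
  obtain ⟨v, q, hvm, hqm, hqb, h0, hsat, hmom, hdiv⟩ := exists_saturated_limit hn hc0 hQo hQb
  set p : SpaceTime n → ℝ := fun y => q y - Q.indicator (fun _ => c) y with hp
  have hvb : ∀ᵐ y, ‖v y‖ ≤ √(n * c) := by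
    filter_upwards [hsat] with y hy
    by_cases hyQ : y ∈ Q
    · exact Real.le_sqrt_of_sq_le (hy hyQ).le
    · rw [(h0 y hyQ).1, norm_zero]
      exact Real.sqrt_nonneg _
  have hpm : Measurable p := hqm.sub (measurable_const.indicator hQo.measurableSet)
  have hvL : MemLp v ⊤ volume := memLp_top_of_bound hvm _ hvb
  have hpL : MemLp p ⊤ volume := by
    refine memLp_top_of_bound hpm.aestronglyMeasurable (2 + c) (Filter.Eventually.of_forall ?_)
    intro y
    refine (norm_sub_le _ _).trans (add_le_add (hqb y) ?_)
    by_cases hyQ : y ∈ Q <;> simp [hyQ, abs_of_pos hc0, hc0.le]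
  have hclosure : IsCompact (closure Q) := hQb.isCompact_closure
  have hvnonzero : ¬ (v =ᵐ[volume] 0) := by
    intro hv0
    have hQ0 : volume Q = 0 := by
      rw [measure_eq_zero_iff_ae_notMem]
      filter_upwards [hv0, hsat] with y h1 h2 hyQ
      have := h2 hyQ
      rw [h1] at this
      have hpos : 0 < n * c := by positivity
      simp at this
      rcases this with h | h
      · omega
      · exact hc0.ne' h
    exact (hQo.measure_pos volume ⟨(0, 0), by simp [hQ, hΩ]⟩).ne' hQ0
  -- Saturation holds almost everywhere in `(x, t)`; swapping the factors puts time first, so that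
  -- Fubini gives it on almost every time slice.
  have hslice : ∀ᵐ t : ℝ, ∀ᵐ x : EuclideanSpace ℝ (Fin n),
      (x, t) ∈ Q → ‖v (x, t)‖ ^ 2 = n * c := by
    have hswap : ∀ᵐ z : ℝ × EuclideanSpace ℝ (Fin n) ∂(volume.prod volume),
        (z.2, z.1) ∈ Q → ‖v (z.2, z.1)‖ ^ 2 = n * c :=
      (Measure.measurePreserving_swap (μ := (volume : Measure ℝ))
        (ν := (volume : Measure (EuclideanSpace ℝ (Fin n))))).quasiMeasurePreserving.ae hsat
    exact Measure.ae_ae_of_ae_prod hswap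
  refine ⟨v, p, hvL, hpL, ⟨?_, ?_, ?_, ?_, ?_, ?_⟩, hvnonzero, ?_, ?_, ?_, ?_⟩
  · exact locallyIntegrable_const 0
  · exact hvL.locallyIntegrable le_top
  · have : MemLp (fun y => ‖v y‖ ^ 2) ⊤ volume :=
      memLp_top_of_bound (hvm.norm.pow 2) (√(n * c) ^ 2) (by
        filter_upwards [hvb] with y hy
        rw [Real.norm_of_nonneg (sq_nonneg _)]
        exact pow_le_pow_left₀ (norm_nonneg _) hy 2)
    exact this.locallyIntegrable le_top
  · exact hpL.locallyIntegrable le_top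
  · intro φ hφ hφc
    have := hmom φ hφ hφc
    -- The multiple `c 1_Q` of the identity in the stress is a pure pressure and is absorbed in `p`.
    simp only [momentumPairing_sub_scalar φ _ _ (fun i j => _)] at this
    simpa [momentumPairing] using this
  · exact hdiv
  · exact HasCompactSupport.intro hclosure fun y hy => (h0 y fun h => hy (subset_closure h)).1
  · refine HasCompactSupport.intro hclosure fun y hy => ?_
    have hyQ : y ∉ Q := fun h => hy (subset_closure h)
    simp [hp, (h0 y hyQ).2, hyQ]
  · filter_upwards [hslice] with t ht htI
    rw [← setIntegral_eq_integral_of_forall_compl_eq_zero (s := Ω)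
      (fun x hx => by simp [(h0 (x, t) fun h => hx h.1).1])]
    have : ∫ x in Ω, ‖v (x, t)‖ ^ 2 = ∫ _ in Ω, n * c := by
      refine setIntegral_congr_ae Metric.isOpen_ball.measurableSet ?_
      filter_upwards [ht] with x hx hxΩ
      exact hx ⟨hxΩ, htI⟩
    rw [this, setIntegral_const, smul_eq_mul, mul_comm, hnc]
  · intro x t ht
    refine (h0 (x, t) fun h => ?_).1
    exact absurd (abs_lt.2 h.2) (not_lt.2 ht.le)
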